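/- Let $n\ge 1$, let $m=(m_1,\dots,m_n)$ be positive integers, and let $T=(T_1,\dots,T_n)$ be bounded operators on a complex Hilbert space $H$ that are doubly commuting: $T_iT_j=T_jT_i$ for all $i,j$ and $T_pT_q^*=T_q^*T_p$ for $p<q$. Assume that $T$ is $B_m$-contractive, that is: for each $i$, $T_i^{*l}\to 0$ strongly as $l\to\infty$ and $\sum_{k=0}^{m_i}(-1)^k\binom{m_i}{k}T_i^kT_i^{*k}\ge 0$; and $$B_m^{-1}(T,T^*):=\sum_{0\le k_i\le m_i}\Big(\prod_{i=1}^n(-1)^{k_i}\binom{m_i}{k_i}\Big)T_1^{k_1}\cdots T_n^{k_n}\,T_1^{*k_1}\cdots T_n^{*k_n}\ \ge 0 .$$ Put $D_{m,T}=(B_m^{-1}(T,T^*))^{1/2}$ and $\mathcal D_{m,T}=\overline{\operatorname{ran}}\,D_{m,T}$. For a Hilbert space $E$ and positive integers $p=(p_1,\dots,p_d)$ let $A^2_p(E)$ be the Hilbert space of $E$-valued functions on the polydisc $\mathbb D^d$ with reproducing kernel $\prod_{i=1}^d(1-z_i\bar w_i)^{-p_i}I_E$. A multiplier from $A^2_p(E)$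 to $A^2_q(F)$ is a holomorphic map $\Theta:\mathbb D^d\to B(E,F)$ with $\Theta f\in A^2_q(F)$ for all $f\in A^2_p(E)$; it is partially isometric if $M_\Theta f=\Theta f$ is a partial isometry. Let $\hat m_k$ denote $m$ with its $k$-th entry replaced by $1$. Then there are Hilbert spaces $E_1,\dots,E_n$ and partially isometric multipliers $\theta_k:\mathbb D\to B(E_k,\mathcal D_{m,T})$ from $A^2_1(E_k)$ to $A^2_{m_k}(\mathcal D_{m,T})$, $k=1,\dots,n$ (spaces over $\mathbb D$), such that the following hold. Each $\Theta_k(z)=\theta_k(z_k)$, $z\in\mathbb D^n$, is a partially isometric multiplier from $A^2_{\hat m_k}(E_k)$ to $A^2_m(\mathcal D_{m,T})$ (spaces over $\mathbb D^n$); the sum $\sum_{i=1}^n\Theta_iA^2_{\hat m_i}(E_i)$ is closed in $A^2_m(\mathcal D_{m,T})$; and with $$\mathcal Q_\Theta=A^2_m(\mathcal D_{m,T})\ominus\sum_{i=1}^n\Theta_iA^2_{\hat m_i}(E_i)$$ there is a unitary $U:H\to\mathcal Q_\Theta$ with $U\,T_i=P_{\mathcal Q_\Theta}M_{z_i}|_{\mathcal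 Q_\Theta}\,U$ for $i=1,\dots,n$, where $M_{z_i}$ is multiplication by $z_i$ on $A^2_m(\mathcal D_{m,T})$. -/

import Mathlib

universe u

noncomputable section

open scoped ComplexConjugate InnerProductSpace

namespace BergmanModel

/-! ### Weighted Bergman spaces over the polydisc -/

/-- The open unit polydisc `𝔻ⁿ ⊆ ℂⁿ`. -/
def polydisc (n : ℕ) : Set (Fin n → ℂ) := {z | ∀ i, ‖z i‖ < 1}

/-- The Taylor coefficient `∏ᵢ C(mᵢ + kᵢ - 1, kᵢ)` of `(z w̄)ᵏ` in the weighted Bergman kernel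
`∏ᵢ (1 - zᵢ w̄ᵢ)^(-mᵢ)`. -/
def kernelCoeff {n : ℕ} (m : Fin n → ℕ+) (k : Fin n → ℕ) : ℕ :=
  ∏ i, ((m i : ℕ) + k i - 1).choose (k i)

/-- The orthonormal monomials `√(∏ᵢ C(mᵢ + kᵢ - 1, kᵢ)) zᵏ` of the weighted Bergman space. -/
def basisMonomial {n : ℕ} (m : Fin n → ℕ+) (k : Fin n → ℕ) (z : Fin n → ℂ) : ℂ :=
  (Real.sqrt (kernelCoeff m k) : ℂ) * ∏ i, z i ^ k i

lemma kernelCoeff_pos {n : ℕ} (m : Fin n → ℕ+) (k : Fin n → ℕ) : 0 < kernelCoeff m k := by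
  refine Finset.prod_pos fun i _ => Nat.choose_pos ?_
  have := (m i).pos
  omega

lemma kernelCoeff_le {n : ℕ} (m : Fin n → ℕ+) (k : Fin n → ℕ) (i : Fin n) :
    kernelCoeff m k ≤ kernelCoeff m (k + Pi.single i 1) := by
  refine Finset.prod_le_prod' fun j _ => ?_
  have hm := (m j).pos
  obtain ⟨p, hp⟩ : ∃ p, (m j : ℕ) = p + 1 := ⟨m j - 1, by omega⟩
  have hle : k j ≤ (k + Pi.single i 1 : Fin n → ℕ) j := by simp
  generalize (k + Pi.single i 1 : Fin n → ℕ) j = l at hle ⊢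
  rw [hp, show p + 1 + k j - 1 = p + k j by omega, show p + 1 + l - 1 = p + l by omega,
    ← Nat.choose_symm_add, ← Nat.choose_symm_add]
  exact Nat.choose_le_choose _ (by omega)

lemma hasSum_pi_prod {n : ℕ} (g : Fin n → ℕ → ℂ) (s : Fin n → ℂ)
    (hg : ∀ i, HasSum (g i) (s i)) :
    HasSum (fun k : Fin n → ℕ => ∏ i, g i (k i)) (∏ i, s i) := by
  induction n with
  | zero => simp [hasSum_unique]
  | succ n ih =>
    have h1 := ih (fun i => g i.succ) (fun i => s i.succ) (fun i => hg _)
    have hs := summable_mul_of_summable_norm (hg 0).summable.norm h1.summable.norm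
    have h2 := (hg 0).mul h1 hs
    rw [← (Fin.consEquiv fun _ => ℕ).hasSum_iff]
    simpa [Function.comp_def, Fin.prod_univ_succ, Fin.consEquiv] using h2

lemma hasSum_kernelCoeff {n : ℕ} (m : Fin n → ℕ+) (x : Fin n → ℂ) (hx : ∀ i, ‖x i‖ < 1) :
    HasSum (fun k => (kernelCoeff m k : ℂ) * ∏ i, x i ^ k i)
      (∏ i, ((1 - x i) ^ (m i : ℕ))⁻¹) := by
  have h := hasSum_pi_prod (fun i j => (((m i : ℕ) + j - 1).choose j : ℂ) * x i ^ j)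
    (fun i => ((1 - x i) ^ (m i : ℕ))⁻¹) (fun i => by
      have hm := (m i).pos
      obtain ⟨p, hp⟩ : ∃ p, (m i : ℕ) = p + 1 := ⟨m i - 1, by omega⟩
      have := hasSum_choose_mul_geometric_of_norm_lt_one p (hx i)
      simp only [hp, one_div] at this ⊢
      convert! this using 4 with j
      rw [show p + 1 + j - 1 = j + p by omega, Nat.choose_symm_add])
  simpa [kernelCoeff, Finset.prod_mul_distrib] using h

lemma basisMonomial_mul {n : ℕ} (m : Fin n → ℕ+) (k : Fin n → ℕ) (z w : Fin n → ℂ) :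
    basisMonomial m k z * conj (basisMonomial m k w) =
      (kernelCoeff m k : ℂ) * ∏ i, (z i * conj (w i)) ^ k i := by
  have : ((Real.sqrt (kernelCoeff m k) : ℝ) : ℂ) * (Real.sqrt (kernelCoeff m k) : ℝ)
      = (kernelCoeff m k : ℂ) := by
    rw [← Complex.ofReal_mul, Real.mul_self_sqrt (by positivity)]; simp
  rw [← this]
  simp only [basisMonomial, map_mul, Complex.conj_ofReal, map_prod, map_pow, mul_pow,
    Finset.prod_mul_distrib]
  ring

lemma hasSum_basisMonomial_mul {n : ℕ} (m : Fin n → ℕ+) {z w : Fin n → ℂ}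
    (hz : z ∈ polydisc n) (hw : w ∈ polydisc n) :
    HasSum (fun k => basisMonomial m k z * conj (basisMonomial m k w))
      (∏ i, ((1 - z i * conj (w i)) ^ (m i : ℕ))⁻¹) := by
  simp only [basisMonomial_mul]
  refine hasSum_kernelCoeff m _ fun i => ?_
  rw [norm_mul, RCLike.norm_conj]
  exact mul_lt_one_of_nonneg_of_lt_one_left (norm_nonneg _) (hz i) (hw i).le

lemma summable_norm_basisMonomial_sq {n : ℕ} (m : Fin n → ℕ+) {z : Fin n → ℂ}
    (hz : z ∈ polydisc n) : Summable fun k => ‖basisMonomial m k z‖ ^ 2 := by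
  have := (hasSum_basisMonomial_mul m hz hz).summable.norm
  simpa [sq] using this

lemma coeff_eq_zero_of_hasSum {n : ℕ} (a : (Fin n → ℕ) → ℂ)
    (h : ∀ z ∈ polydisc n, HasSum (fun k => a k * ∏ i, z i ^ k i) 0) (k : Fin n → ℕ) :
    a k = 0 := by
  induction n with
  | zero =>
    have h1 := h 0 (fun i => i.elim0)
    have h2 := hasSum_unique (fun k : Fin 0 → ℕ => a k * ∏ i, (0 : Fin 0 → ℂ) i ^ k i)
    have := h1.unique h2
    simp only [Finset.univ_eq_empty, Finset.prod_empty, mul_one] at this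
    rw [this]
    congr 1
    exact Subsingleton.elim _ _
  | succ n ih =>
    have key : ∀ z ∈ polydisc n, ∀ t : ℂ, ‖t‖ < 1 →
        HasSum (fun p : ℕ × (Fin n → ℕ) => t ^ p.1 *
          (a (Fin.cons p.1 p.2) * ∏ i, z i ^ p.2 i)) 0 := by
      intro z hz t ht
      have h1 := h (Fin.cons t z) (fun i => by
        refine Fin.cases ?_ (fun j => ?_) i
        · simpa using ht
        · simpa using hz j)
      rw [← (Fin.consEquiv fun _ => ℕ).hasSum_iff] at h1
      convert! h1 using 2 with p
      simp [Fin.consEquiv, Fin.prod_univ_succ]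
      ring
    have hsum : ∀ z ∈ polydisc n, ∀ j : ℕ,
        Summable fun k' : Fin n → ℕ => a (Fin.cons j k') * ∏ i, z i ^ k' i := by
      intro z hz j
      have h1 := (key z hz (1 / 2) (by norm_num)).summable.prod_factor j
      have h2 : ((1 / 2 : ℂ)) ^ j ≠ 0 := pow_ne_zero j (by norm_num)
      exact (summable_mul_left_iff h2).1 h1
    have hzero : ∀ z ∈ polydisc n, ∀ j : ℕ,
        HasSum (fun k' : Fin n → ℕ => a (Fin.cons j k') * ∏ i, z i ^ k' i) 0 := by
      intro z hz j
      obtain ⟨b, hb⟩ : ∃ b : ℕ → ℂ, ∀ j, HasSum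
          (fun k' : Fin n → ℕ => a (Fin.cons j k') * ∏ i, z i ^ k' i) (b j) :=
        ⟨_, fun j => (hsum z hz j).hasSum⟩
      have hbt : ∀ t : ℂ, ‖t‖ < 1 → HasSum (fun j => t ^ j * b j) 0 := by
        intro t ht
        exact HasSum.prod_fiberwise (key z hz t ht) fun j => (hb j).mul_left (t ^ j)
      have hp : HasFPowerSeriesAt (0 : ℂ → ℂ) (FormalMultilinearSeries.ofScalars ℂ b) 0 := by
        rw [hasFPowerSeriesAt_iff]
        filter_upwards [Metric.ball_mem_nhds (0 : ℂ) one_pos] with t ht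
        simpa [FormalMultilinearSeries.coeff_ofScalars] using hbt t (by simpa using ht)
      have hb0 : b j = 0 := by
        have := congrArg (fun p => FormalMultilinearSeries.coeff p j) hp.eq_zero
        rw [FormalMultilinearSeries.coeff_ofScalars] at this
        exact this.trans rfl
      rw [← hb0]
      exact hb j
    have := ih (fun k' => a (Fin.cons (k 0) k')) (fun z hz => hzero z hz (k 0)) (Fin.tail k)
    simpa using this


/-- The `E`-valued weighted Bergman space `A²_m(E)` over the polydisc `𝔻ⁿ`: the element with
coefficients `f k` is the function `z ↦ ∑ₖ √(∏ᵢ C(mᵢ + kᵢ - 1, kᵢ)) zᵏ f k`, with squared norm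
`∑ₖ ‖f k‖²`. By `Bergman.kernel_eq` below it is the reproducing kernel Hilbert space of
`E`-valued functions on `𝔻ⁿ` with kernel `∏ᵢ (1 - zᵢ w̄ᵢ)^(-mᵢ) I_E`. -/
def Bergman {n : ℕ} (_m : Fin n → ℕ+) (E : Type*) [NormedAddCommGroup E] : Type _ :=
  lp (fun _ : Fin n → ℕ => E) 2

namespace Bergman

variable {n : ℕ} {m : Fin n → ℕ+}
variable {E : Type*} [NormedAddCommGroup E]

instance : NormedAddCommGroup (Bergman m E) :=
  inferInstanceAs (NormedAddCommGroup (lp (fun _ : Fin n → ℕ => E) 2))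

instance [InnerProductSpace ℂ E] : InnerProductSpace ℂ (Bergman m E) :=
  inferInstanceAs (InnerProductSpace ℂ (lp (fun _ : Fin n → ℕ => E) 2))

instance [CompleteSpace E] : CompleteSpace (Bergman m E) :=
  inferInstanceAs (CompleteSpace (lp (fun _ : Fin n → ℕ => E) 2))

/-- The coefficient of `f` at the orthonormal monomial with exponent `k`. -/
def coeff (f : Bergman m E) (k : Fin n → ℕ) : E :=
  (show lp (fun _ : Fin n → ℕ => E) 2 from f) k

/-- The element of `A²_m(E)` with prescribed square summable coefficients. -/
def mk (a : (Fin n → ℕ) → E) (ha : Summable fun k => ‖a k‖ ^ 2) : Bergman m E :=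
  (⟨a, memℓp_gen (by simpa using ha)⟩ : lp (fun _ : Fin n → ℕ => E) 2)

@[simp] lemma coeff_mk (a : (Fin n → ℕ) → E) (ha : Summable fun k => ‖a k‖ ^ 2) :
    coeff (mk a ha : Bergman m E) = a := rfl

@[ext] lemma ext_coeff {f g : Bergman m E} (h : ∀ k, coeff f k = coeff g k) : f = g :=
  lp.ext (funext h)

lemma summable_norm_coeff_sq (f : Bergman m E) : Summable fun k => ‖coeff f k‖ ^ 2 := by
  have h := (lp.memℓp (show lp (fun _ : Fin n → ℕ => E) 2 from f)).summable (by norm_num)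
  simp only [ENNReal.toReal_ofNat, Real.rpow_ofNat] at h
  exact h

lemma norm_sq_eq_tsum (f : Bergman m E) : ‖f‖ ^ 2 = ∑' k, ‖coeff f k‖ ^ 2 := by
  have h := lp.norm_rpow_eq_tsum (p := 2) (by norm_num)
    (show lp (fun _ : Fin n → ℕ => E) 2 from f)
  simp only [ENNReal.toReal_ofNat, Real.rpow_ofNat] at h
  exact h

lemma coeff_add (f g : Bergman m E) (k : Fin n → ℕ) :
    coeff (f + g) k = coeff f k + coeff g k := rfl

variable [InnerProductSpace ℂ E]

lemma coeff_smul (c : ℂ) (f : Bergman m E) (k : Fin n → ℕ) :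
    coeff (c • f) k = c • coeff f k := rfl

lemma hasSum_inner (f g : Bergman m E) :
    HasSum (fun k => ⟪coeff f k, coeff g k⟫_ℂ) ⟪f, g⟫_ℂ :=
  lp.hasSum_inner _ _

lemma summable_norm_eval (f : Bergman m E) {z : Fin n → ℂ} (hz : z ∈ polydisc n) :
    Summable fun k => ‖basisMonomial m k z • coeff f k‖ := by
  refine Summable.of_nonneg_of_le (fun k => norm_nonneg _) (fun k => ?_)
    ((summable_norm_basisMonomial_sq m hz).add (summable_norm_coeff_sq f))
  rw [norm_smul]
  nlinarith [sq_nonneg (‖basisMonomial m k z‖ - ‖coeff f k‖),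
    sq_nonneg ‖basisMonomial m k z‖, sq_nonneg ‖coeff f k‖]

variable [CompleteSpace E]

lemma summable_eval (f : Bergman m E) {z : Fin n → ℂ} (hz : z ∈ polydisc n) :
    Summable fun k => basisMonomial m k z • coeff f k :=
  (summable_norm_eval f hz).of_norm

/-- Evaluation of an element of `A²_m(E)` at a point of the polydisc. -/
def evalCLM (m : Fin n → ℕ+) (E : Type*) [NormedAddCommGroup E] [InnerProductSpace ℂ E]
    [CompleteSpace E] (z : polydisc n) : Bergman m E →L[ℂ] E :=
  LinearMap.mkContinuous
    { toFun := fun f => ∑' k, basisMonomial m k z • coeff f k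
      map_add' := fun f g => by
        simp only [coeff_add, smul_add]
        exact (summable_eval f z.2).tsum_add (summable_eval g z.2)
      map_smul' := fun c f => by
        simp only [coeff_smul, RingHom.id_apply, smul_comm _ c]
        exact (summable_eval f z.2).tsum_const_smul c }
    (Real.sqrt (∑' k, ‖basisMonomial m k (z : Fin n → ℂ)‖ ^ 2)) (fun f => by
      have h1 := norm_tsum_le_tsum_norm (summable_norm_eval f z.2)
      have h2 := Real.inner_le_Lp_mul_Lq_tsum_of_nonneg (p := 2) (q := 2)
        Real.HolderConjugate.two_two
        (f := fun k => ‖basisMonomial m k (z : Fin n → ℂ)‖) (g := fun k => ‖coeff f k‖)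
        (fun _ => norm_nonneg _) (fun _ => norm_nonneg _)
        (by simpa using summable_norm_basisMonomial_sq m z.2)
        (by simpa using summable_norm_coeff_sq f)
      simp only [norm_smul] at h1
      simp only [Real.rpow_ofNat] at h2
      refine h1.trans (h2.trans_eq ?_)
      rw [← norm_sq_eq_tsum, ← Real.sqrt_eq_rpow, ← Real.sqrt_eq_rpow,
        Real.sqrt_sq (norm_nonneg _)])

lemma hasSum_evalCLM (f : Bergman m E) (z : polydisc n) :
    HasSum (fun k => basisMonomial m k z • coeff f k) (evalCLM m E z f) :=
  (summable_eval f z.2).hasSum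

/-- `A²_m(E)` is a reproducing kernel Hilbert space of functions on the polydisc. -/
instance : RKHS ℂ (Bergman m E) (polydisc n) E where
  coeCLM := .pi (evalCLM m E)
  coeCLM_injective := by
    refine (injective_iff_map_eq_zero _).2 fun f hf => ?_
    refine ext_coeff fun k => ?_
    refine ext_inner_left ℂ fun v => ?_
    have h := coeff_eq_zero_of_hasSum
      (fun k => (Real.sqrt (kernelCoeff m k) : ℂ) * ⟪v, coeff f k⟫_ℂ) (fun z hz => by
        have h1 := (hasSum_evalCLM f ⟨z, hz⟩).mapL (innerSL ℂ v)
        have h2 : evalCLM m E ⟨z, hz⟩ f = 0 := congrFun hf ⟨z, hz⟩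
        rw [h2, map_zero] at h1
        convert! h1 using 2 with k
        simp [basisMonomial]
        ring) k
    have hc : (Real.sqrt (kernelCoeff m k) : ℂ) ≠ 0 := by
      have := kernelCoeff_pos m k
      exact_mod_cast (Real.sqrt_pos.2 (by exact_mod_cast this)).ne'
    have h0 := (mul_eq_zero.1 h).resolve_left hc
    rw [h0]
    exact (inner_zero_right v).symm

/-- Elements of `A²_m(E)` as functions on the polydisc. -/
lemma hasSum_apply (f : Bergman m E) (z : polydisc n) :
    HasSum (fun k => basisMonomial m k z • coeff f k) (f z) :=
  hasSum_evalCLM f z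

lemma coeff_kerFun (w : polydisc n) (v : E) (k : Fin n → ℕ) :
    coeff (RKHS.kerFun (Bergman m E) w v) k = conj (basisMonomial m k w) • v := by
  classical
  refine ext_inner_right ℂ fun x => ?_
  have hs : Summable fun j => ‖(Pi.single k x : (Fin n → ℕ) → E) j‖ ^ 2 :=
    summable_of_ne_finset_zero (s := {k}) fun j hj => by
      rw [Pi.single_eq_of_ne (by simpa using hj)]; simp
  set g : Bergman m E := mk (Pi.single k x) hs with hg
  have h1 : ⟪RKHS.kerFun (Bergman m E) w v, g⟫_ℂ = ⟪v, g w⟫_ℂ := RKHS.kerFun_inner w v g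
  have h2 : g w = basisMonomial m k w • x := by
    refine (hasSum_apply g w).unique ?_
    convert! hasSum_single k (f := fun j => basisMonomial m j (w : Fin n → ℂ) • coeff g j) ?_
    · simp [hg]
    · intro j hj
      simp [hg, Pi.single_eq_of_ne hj]
  have h3 : ⟪RKHS.kerFun (Bergman m E) w v, g⟫_ℂ =
      ⟪coeff (RKHS.kerFun (Bergman m E) w v) k, x⟫_ℂ := by
    refine (hasSum_inner _ g).unique ?_
    convert! hasSum_single k
      (f := fun j => ⟪coeff (RKHS.kerFun (Bergman m E) w v) j, coeff g j⟫_ℂ) ?_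
    · simp [hg]
    · intro j hj
      simp [hg, Pi.single_eq_of_ne hj]
  rw [← h3, h1, h2, inner_smul_right, inner_smul_left]
  simp

/-- The reproducing kernel of `A²_m(E)` is `∏ᵢ (1 - zᵢ w̄ᵢ)^(-mᵢ) I_E`. -/
theorem kernel_eq (z w : polydisc n) :
    RKHS.kernel (Bergman m E) z w =
      (∏ i, ((1 - (z : Fin n → ℂ) i * conj ((w : Fin n → ℂ) i)) ^ (m i : ℕ))⁻¹) •
        ContinuousLinearMap.id ℂ E := by
  ext v
  rw [← RKHS.kerFun_apply]
  refine (hasSum_apply _ z).unique ?_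
  simp only [coeff_kerFun, smul_smul]
  exact (hasSum_basisMonomial_mul m z.2 w.2).smul_const v

end Bergman

/-! ### Multipliers -/

section Multipliers

variable {n : ℕ}
variable {E₁ E₂ : Type*} [NormedAddCommGroup E₁] [InnerProductSpace ℂ E₁] [CompleteSpace E₁]
  [NormedAddCommGroup E₂] [InnerProductSpace ℂ E₂] [CompleteSpace E₂]

/-- `Θ` is a multiplier from `A²_{m₁}(E₁)` to `A²_{m₂}(E₂)`: an operator-valued holomorphic map on
the polydisc with `Θ f ∈ A²_{m₂}(E₂)` for all `f ∈ A²_{m₁}(E₁)`. Only the values of `Θ` on the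
polydisc matter. -/
structure IsMultiplier (m₁ m₂ : Fin n → ℕ+) (Θ : (Fin n → ℂ) → E₁ →L[ℂ] E₂) : Prop where
  holomorphic : DifferentiableOn ℂ Θ (polydisc n)
  maps : ∀ f : Bergman m₁ E₁, ∃ g : Bergman m₂ E₂, ∀ z : polydisc n, g z = Θ z (f z)

/-- The function `Θ f`, as an element of `A²_{m₂}(E₂)`. -/
def IsMultiplier.mulFun {m₁ m₂ : Fin n → ℕ+} {Θ : (Fin n → ℂ) → E₁ →L[ℂ] E₂}
    (h : IsMultiplier m₁ m₂ Θ) (f : Bergman m₁ E₁) : Bergman m₂ E₂ :=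
  (h.maps f).choose

lemma IsMultiplier.mulFun_apply {m₁ m₂ : Fin n → ℕ+} {Θ : (Fin n → ℂ) → E₁ →L[ℂ] E₂}
    (h : IsMultiplier m₁ m₂ Θ) (f : Bergman m₁ E₁) (z : polydisc n) :
    h.mulFun f z = Θ z (f z) :=
  (h.maps f).choose_spec z

/-- The multiplication operator `M_Θ f = Θ f` of a multiplier `Θ`; it is bounded by the closed
graph theorem. -/
def IsMultiplier.mulOp {m₁ m₂ : Fin n → ℕ+} {Θ : (Fin n → ℂ) → E₁ →L[ℂ] E₂}
    (h : IsMultiplier m₁ m₂ Θ) : Bergman m₁ E₁ →L[ℂ] Bergman m₂ E₂ :=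
  ContinuousLinearMap.ofSeqClosedGraph
    (g := { toFun := h.mulFun
            map_add' := fun f₁ f₂ => RKHS.ext fun z => by simp [h.mulFun_apply]
            map_smul' := fun c f => RKHS.ext fun z => by simp [h.mulFun_apply] })
    (fun u x y hu hy => RKHS.ext fun z => by
      have h1 : Filter.Tendsto (fun j => h.mulFun (u j) z) Filter.atTop (nhds (y z)) :=
        ((RKHS.continuous_eval z).tendsto y).comp hy
      have h2 : Filter.Tendsto (fun j => Θ z (u j z)) Filter.atTop (nhds (Θ z (x z))) :=
        (((Θ z).continuous.comp (RKHS.continuous_eval z)).tendsto x).comp hu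
      simp only [h.mulFun_apply] at h1
      exact (tendsto_nhds_unique h1 h2).trans (h.mulFun_apply x z).symm)

@[simp] lemma IsMultiplier.mulOp_apply {m₁ m₂ : Fin n → ℕ+} {Θ : (Fin n → ℂ) → E₁ →L[ℂ] E₂}
    (h : IsMultiplier m₁ m₂ Θ) (f : Bergman m₁ E₁) (z : polydisc n) :
    h.mulOp f z = Θ z (f z) :=
  h.mulFun_apply f z

/-- A bounded operator is a partial isometry if it is isometric on the orthogonal complement of
its kernel. -/
def IsPartialIsometry {K₁ K₂ : Type*} [NormedAddCommGroup K₁] [InnerProductSpace ℂ K₁]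
    [NormedAddCommGroup K₂] [InnerProductSpace ℂ K₂] (A : K₁ →L[ℂ] K₂) : Prop :=
  ∀ x ∈ (LinearMap.ker (A : K₁ →ₗ[ℂ] K₂))ᗮ, ‖A x‖ = ‖x‖

/-- A partially isometric multiplier: a multiplier `Θ` such that `M_Θ` is a partial isometry. -/
def IsPartiallyIsometricMultiplier (m₁ m₂ : Fin n → ℕ+) (Θ : (Fin n → ℂ) → E₁ →L[ℂ] E₂) : Prop :=
  ∃ h : IsMultiplier m₁ m₂ Θ, IsPartialIsometry h.mulOp

/-- The one-variable function `θ` as a function of the `i`-th of `n` variables,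
`z ↦ θ(zᵢ)`. For `n = 1` and `i = 0` this is `θ` itself, as a function on `ℂ¹`. -/
def inVar {F : Type*} (i : Fin n) (θ : ℂ → F) : (Fin n → ℂ) → F := fun z => θ (z i)

/-- The coordinate function `zᵢ` is a multiplier of `A²_m(E)`. -/
lemma isMultiplier_coord (m : Fin n → ℕ+) (E : Type*) [NormedAddCommGroup E]
    [InnerProductSpace ℂ E] [CompleteSpace E] (i : Fin n) :
    IsMultiplier m m (fun z : Fin n → ℂ => z i • ContinuousLinearMap.id ℂ E) where
  holomorphic := by fun_prop
  maps f := by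
    set σ : (Fin n → ℕ) → (Fin n → ℕ) := fun k => k + Pi.single i 1 with hσ
    have hinj : Function.Injective σ := add_left_injective _
    set b : (Fin n → ℕ) → E := fun k =>
      ((Real.sqrt (kernelCoeff m k) / Real.sqrt (kernelCoeff m (σ k)) : ℝ) : ℂ) • f.coeff k with hb
    have hbs : Summable fun k => ‖b k‖ ^ 2 := by
      refine Summable.of_nonneg_of_le (fun k => sq_nonneg _) (fun k => ?_)
        f.summable_norm_coeff_sq
      have hle : Real.sqrt (kernelCoeff m k) / Real.sqrt (kernelCoeff m (σ k)) ≤ 1 :=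
        div_le_one_of_le₀ (Real.sqrt_le_sqrt (by exact_mod_cast kernelCoeff_le m k i))
          (Real.sqrt_nonneg _)
      rw [hb]
      simp only [norm_smul, Complex.norm_real, Real.norm_eq_abs]
      rw [abs_of_nonneg (by positivity)]
      gcongr
      exact mul_le_of_le_one_left (norm_nonneg _) hle
    have hext : ∀ k, ‖Function.extend σ b 0 k‖ ^ 2 =
        Function.extend σ (fun k => ‖b k‖ ^ 2) 0 k := by
      intro k
      by_cases hk : ∃ j, σ j = k
      · obtain ⟨j, rfl⟩ := hk
        rw [hinj.extend_apply, hinj.extend_apply]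
      · rw [Function.extend_apply' _ _ _ hk, Function.extend_apply' _ _ _ hk]
        simp
    refine ⟨Bergman.mk (Function.extend σ b 0) ?_, fun z => ?_⟩
    · simp only [hext]
      exact (summable_extend_zero hinj).2 hbs
    · refine (Bergman.hasSum_apply _ z).unique ?_
      rw [← hinj.hasSum_iff]
      · have h1 := (Bergman.hasSum_apply f z).const_smul ((z : Fin n → ℂ) i)
        convert! h1 using 2 with k
        simp only [Function.comp_apply, Bergman.coeff_mk, hinj.extend_apply, hb, smul_smul]
        congr 1
        have hc : (Real.sqrt (kernelCoeff m (σ k)) : ℂ) ≠ 0 := by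
          have := kernelCoeff_pos m (σ k)
          exact_mod_cast (Real.sqrt_pos.2 (by exact_mod_cast this)).ne'
        have hp : ∏ j, (z : Fin n → ℂ) j ^ (σ k) j =
            (z : Fin n → ℂ) i * ∏ j, (z : Fin n → ℂ) j ^ k j := by
          simp only [hσ, Pi.add_apply, pow_add, Finset.prod_mul_distrib]
          rw [mul_comm]
          congr 1
          rw [Finset.prod_eq_single i (fun j _ hj => by simp [Pi.single_eq_of_ne hj])
            (fun h => absurd (Finset.mem_univ i) h)]
          simp
        simp only [basisMonomial, hp, Complex.ofReal_div]
        field_simp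
      · intro k hk
        rw [Bergman.coeff_mk, Function.extend_apply' _ _ _ (by simpa using hk)]
        simp

/-- The multiplication operator `M_{zᵢ}` on `A²_m(E)`. -/
def shift (m : Fin n → ℕ+) (E : Type*) [NormedAddCommGroup E]
    [InnerProductSpace ℂ E] [CompleteSpace E] (i : Fin n) : Bergman m E →L[ℂ] Bergman m E :=
  (isMultiplier_coord m E i).mulOp

@[simp] lemma shift_apply (m : Fin n → ℕ+) (E : Type*) [NormedAddCommGroup E]
    [InnerProductSpace ℂ E] [CompleteSpace E] (i : Fin n) (f : Bergman m E) (z : polydisc n) :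
    shift m E i f z = (z : Fin n → ℂ) i • f z := by
  simp [shift]

end Multipliers

/-! ### Contractive tuples -/

section Tuples

open ContinuousLinearMap

variable {H : Type*} [NormedAddCommGroup H] [InnerProductSpace ℂ H] [CompleteSpace H]

/-- `B_m⁻¹(z, w)(T, T*) = ∑_{k=0}^m (-1)ᵏ C(m, k) Tᵏ T*ᵏ`. -/
def invKernel (m : ℕ+) (T : H →L[ℂ] H) : H →L[ℂ] H :=
  ∑ k ∈ Finset.range ((m : ℕ) + 1), ((-1) ^ k * ((m : ℕ).choose k : ℂ)) • (T ^ k * adjoint T ^ k)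

/-- `T` is in the class `C_{·0}`: `T*ˡ → 0` in the strong operator topology. -/
def IsPure (T : H →L[ℂ] H) : Prop :=
  ∀ h : H, Filter.Tendsto (fun l : ℕ => (adjoint T ^ l) h) Filter.atTop (nhds 0)

/-- `T` is a `B_m`-contraction. -/
def IsBContraction (m : ℕ+) (T : H →L[ℂ] H) : Prop :=
  IsPure T ∧ (invKernel m T).IsPositive

/-- `T^k = T₁^{k₁} ⋯ Tₙ^{kₙ}`. -/
def tuplePow {n : ℕ} (T : Fin n → H →L[ℂ] H) (k : Fin n → ℕ) : H →L[ℂ] H :=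
  (List.ofFn fun i => T i ^ k i).prod

/-- `B_m⁻¹(z, w)(T, T*)`: the polynomial
`∏ᵢ (1 - zᵢ w̄ᵢ)^{mᵢ} = ∑_{k ≤ m} ∏ᵢ ((-1)^{kᵢ} C(mᵢ, kᵢ)) zᵏ w̄ᵏ`
evaluated by the hereditary functional calculus `zᵖ w̄^q ↦ Tᵖ T*^q`. -/
def jointInvKernel {n : ℕ} (m : Fin n → ℕ+) (T : Fin n → H →L[ℂ] H) : H →L[ℂ] H :=
  ∑ k ∈ Fintype.piFinset (fun i => Finset.range ((m i : ℕ) + 1)),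
    (∏ i, ((-1) ^ k i * ((m i : ℕ).choose (k i) : ℂ))) •
      (tuplePow T k * tuplePow (fun i => adjoint (T i)) k)

/-- `T` is a `B_m`-contractive tuple: a commuting tuple of `B_{mᵢ}`-contractions `Tᵢ` with
`B_m⁻¹(z, w)(T, T*) ≥ 0`. -/
structure IsBContractive {n : ℕ} (m : Fin n → ℕ+) (T : Fin n → H →L[ℂ] H) : Prop where
  commute : ∀ i j, Commute (T i) (T j)
  contraction : ∀ i, IsBContraction (m i) (T i)
  positive : (jointInvKernel m T).IsPositive

/-- `T` is doubly commuting: `Tᵢ Tⱼ = Tⱼ Tᵢ` for all `i, j` and `T_p T_q* = T_q* T_p` for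
`p < q`. -/
structure IsDoublyCommuting {n : ℕ} (T : Fin n → H →L[ℂ] H) : Prop where
  commute : ∀ i j, Commute (T i) (T j)
  commute_adjoint : ∀ p q, p < q → Commute (T p) (adjoint (T q))

/-- The joint defect operator `D_{m,T} = (B_m⁻¹(z, w)(T, T*))^{1/2}`. -/
def defectOp {n : ℕ} (m : Fin n → ℕ+) (T : Fin n → H →L[ℂ] H) : H →L[ℂ] H :=
  CFC.sqrt (jointInvKernel m T)

/-- The joint defect space, the closure of the range of `D_{m,T}`. -/
abbrev defectSpace {n : ℕ} (m : Fin n → ℕ+) (T : Fin n → H →L[ℂ] H) : Submodule ℂ H :=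
  (LinearMap.range (defectOp m T : H →ₗ[ℂ] H)).topologicalClosure

end Tuples

/-! ### The model -/

/-- `m̂_j`: the multi-index `m` with its `j`-th entry replaced by `1`. -/
def hatIndex {n : ℕ} (m : Fin n → ℕ+) (j : Fin n) : Fin n → ℕ+ := Function.update m j 1

section Model

variable {n : ℕ} {m : Fin n → ℕ+}
variable {F : Type*} [NormedAddCommGroup F] [InnerProductSpace ℂ F] [CompleteSpace F]
variable {E : Fin n → Type*} [∀ k, NormedAddCommGroup (E k)] [∀ k, InnerProductSpace ℂ (E k)]
  [∀ k, CompleteSpace (E k)]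

/-- The sum of subspaces `∑ᵢ Θᵢ A²_{m̂ᵢ}(Eᵢ) ⊆ A²_m(F)`, where `Θᵢ(z) = θᵢ(zᵢ)`. -/
def rangeSum {θ : ∀ k, ℂ → E k →L[ℂ] F}
    (hΘ : ∀ i, IsMultiplier (hatIndex m i) m (inVar i (θ i))) : Submodule ℂ (Bergman m F) :=
  ⨆ i, LinearMap.range ((hΘ i).mulOp : Bergman (hatIndex m i) (E i) →ₗ[ℂ] Bergman m F)

end Model

/-- The compression `P_Q A|_Q` of an operator `A` to a closed subspace `Q`. -/
def compression {K : Type*} [NormedAddCommGroup K] [InnerProductSpace ℂ K]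
    (Q : Submodule ℂ K) [Q.HasOrthogonalProjection] (A : K →L[ℂ] K) : Q →L[ℂ] Q :=
  Q.orthogonalProjectionOnto ∘L A ∘L Q.subtypeL

end BergmanModel

end

open BergmanModel

/-!
For a pure operator `T` and an operator `X` put `φ_T X = X - T X T*`. If the `m`-fold defect
`φ_T^m X` is positive then so is `X`, and
`∑ₖ C(m + k - 1, k) T^k (φ_T^m X) T*^k = X` weakly (`hasSum_choose_mul_inner_defectMap`). This is
the source of every isometry below.

Let `T` be a doubly commuting `B_m`-contractive tuple with defects `Δᵢ = B_{mᵢ}⁻¹(Tᵢ, Tᵢ*)`. Double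
commutativity turns the joint defect into the product `Δ = ∏ᵢ Δᵢ`. With `D = Δ^{1/2}` and `F` the
closure of the range of `D`, the map `V h = ∑ₖ c(k) zᵏ D T*ᵏ h`, where `c = kernelCoeff m`, is an
isometry into `A²_m(F)` that intertwines `Tᵢ*` with `M_{zᵢ}*`. Hence `T` is the compression of the
shifts to the range of `V`, and the task is to write the complement of this range as a sum of
ranges of multipliers, each depending on one variable only.

* For each `i` the one-variable series `Wᵢ h = ∑ₖ c(k) zᵏ D Tᵢ*ᵏ h` maps `H` into `A²_{mᵢ}(F)`. Its
  Gram operator `Wᵢ* Wᵢ` is `∏_{j ≠ i} Δⱼ`, and `M_z* Wᵢ = Wᵢ Tᵢ*`. So the orthogonal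
  complement `Sᵢ` of its range is a closed invariant subspace of `A²_{mᵢ}(F)` over the disc.
* Let `P` be the projection onto a closed invariant subspace of a weighted Bergman space over the
  disc. Then `P - M_z P M_z*` is positive, with square root `L` say, and `f ↦ ∑ₖ zᵏ L M_z*ᵏ f` is
  the adjoint of multiplication by the holomorphic function `θ(w) x = (L x)(w)`. By the reproducing
  formula for the pure operator `M_z` and `X = P`, the product of this multiplication operator with
  its adjoint is `P` (`exists_beurling`). So multiplication by `θ` is a partial isometry from the
  Hardy space onto the invariant subspace.
* An operator in one variable acts slice by slice on functions of all variables
  (`Bergman.ampl`). This turns multiplication by `θᵢ` into multiplication by `θᵢ(zᵢ)`, and the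
  projection onto `Sᵢ` into a projection `Pᵢ` of `A²_m(F)`.
* The projection onto the closure of the range of `Wᵢ` maps `zˡ D y` to a multiple of
  `Wᵢ (Tᵢˡ Δᵢ y)` (`IsDoublyCommuting.single_sub_starProjection`). Evaluating the product of the
  `1 - Pᵢ` on monomials therefore gives the coefficients
  `D ∏ᵢ (Tᵢ*^{kᵢ} Tᵢ^{lᵢ} Δᵢ) y = D T*ᵏ Tˡ Δ y`, which are those of `V V*`. As `f` minus the value
  of this product at `f` is a sum of elements of the ranges of the `Pᵢ`, and `Pᵢ V = 0`, the sum of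
  these ranges is exactly the complement of the range of `V`
  (`IsDoublyCommuting.iSup_range_ampl`); in particular it is closed.
-/

noncomputable section

open scoped ComplexConjugate InnerProductSpace

namespace BergmanModel

open ContinuousLinearMap

/-! ### Iterated differences -/

/-- The differences of a null sequence with nonnegative terms sum up to its first term. -/
lemma hasSum_telescope {b : ℕ → ℝ} (hb : Filter.Tendsto b Filter.atTop (nhds 0))
    (h : ∀ k, 0 ≤ b k - b (k + 1)) (l : ℕ) :
    HasSum (fun k => b (l + k) - b (l + k + 1)) (b l) := by
  rw [hasSum_iff_tendsto_nat_of_nonneg (fun k => h _)]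
  have h1 : ∀ N, ∑ k ∈ Finset.range N, (b (l + k) - b (l + k + 1)) = b l - b (l + N) := fun N => by
    have := Finset.sum_range_sub' (fun k => b (l + k)) N
    simpa [add_assoc] using this
  simp only [h1]
  simpa using tendsto_const_nhds.sub (hb.comp (Filter.tendsto_add_atTop_nat l |>.congr
    fun N => Nat.add_comm N l))

lemma sum_range_add_choose (p N : ℕ) :
    ∑ k ∈ Finset.range (N + 1), (p + k).choose k = (p + 1 + N).choose N := by
  induction N with
  | zero => simp
  | succ N ih =>
    rw [Finset.sum_range_succ, ih, show p + 1 + (N + 1) = (p + 1 + N) + 1 by ring,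
      Nat.choose_succ_succ, show p + (N + 1) = p + 1 + N by ring]

/-- If the `(p + 1)`-st differences of a null sequence are nonnegative, then the sequence is
recovered from them by means of the Taylor coefficients of `(1 - x)^(-(p + 1))`. The step from
`p` to `p + 1` interchanges the two summations in `∑ₖ C(p + k, k) ∑ᵢ a (p + 2) (k + i)`. -/
lemma hasSum_choose_mul_difference (p : ℕ) {a : ℕ → ℕ → ℝ}
    (ha : ∀ j k, a (j + 1) k = a j k - a j (k + 1))
    (hlim : ∀ j, Filter.Tendsto (a j) Filter.atTop (nhds 0))
    (hpos : ∀ k, 0 ≤ a (p + 1) k) :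
    HasSum (fun k => ((p + k).choose k : ℝ) * a (p + 1) k) (a 0 0) := by
  induction p with
  | zero =>
    have := hasSum_telescope (hlim 0) (fun k => by rw [← ha]; exact hpos k) 0
    simpa [ha] using this
  | succ p ih =>
    have htel := hasSum_telescope (hlim (p + 1)) (fun k => by rw [← ha]; exact hpos k)
    simp only [← ha] at htel
    have h1 := ih fun k => (htel k).nonneg fun i => hpos _
    set f : ℕ × ℕ → ℝ := fun q => ((p + q.1).choose q.1 : ℝ) * a (p + 2) (q.1 + q.2) with hf
    have hf0 : 0 ≤ f := fun q => mul_nonneg (by positivity) (hpos _)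
    have hrow : ∀ k, HasSum (fun i => f (k, i)) (((p + k).choose k : ℝ) * a (p + 1) k) :=
      fun k => (htel k).mul_left _
    have hs : Summable f := by
      refine (summable_prod_of_nonneg hf0).2 ⟨fun k => (hrow k).summable, ?_⟩
      simpa only [(hrow _).tsum_eq] using h1.summable
    have hfs : HasSum f (a 0 0) := by
      have h2 := hs.hasSum
      rwa [(h2.prod_fiberwise hrow).unique h1] at h2
    rw [← (Finset.HasAntidiagonal.sigmaAntidiagonalEquivProd (A := ℕ)).hasSum_iff] at hfs
    have h3 := hfs.sigma fun N => hasSum_fintype _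
    convert! h3 using 2 with N
    have h4 : ∑ q : Finset.HasAntidiagonal.antidiagonal N, f q.1 =
        ∑ q ∈ Finset.HasAntidiagonal.antidiagonal N, ((p + q.1).choose q.1 : ℝ) * a (p + 2) N := by
      rw [Finset.univ_eq_attach, Finset.sum_attach (Finset.HasAntidiagonal.antidiagonal N) f]
      refine Finset.sum_congr rfl fun q hq => ?_
      simp only [hf, Finset.HasAntidiagonal.mem_antidiagonal.1 hq]
    refine Eq.trans ?_ h4.symm
    rw [← Finset.sum_mul, Finset.Nat.sum_antidiagonal_eq_sum_range_succ_mk]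
    congr 1
    rw [← sum_range_add_choose]
    push_cast
    rfl

/-! ### Hereditary positivity of pure operators -/

variable {H : Type*} [NormedAddCommGroup H] [InnerProductSpace ℂ H] [CompleteSpace H]

/-- The map `X ↦ X - T X T*` on operators. -/
def defectMap (T X : H →L[ℂ] H) : H →L[ℂ] H := X - T * X * adjoint T

/-- If `G` commutes with `T*`, then the `m`-fold defect of `G` is `B_m⁻¹(T, T*) G`. -/
lemma defectMap_iterate_eq_invKernel_mul (m : ℕ+) {T G : H →L[ℂ] H}
    (h2 : Commute (adjoint T) G) : (defectMap T)^[m] G = invKernel m T * G := by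
  have h0 : ∀ j : ℕ, (defectMap T)^[j] G =
      (((-1 : ℂ) • (LinearMap.mulLeft ℂ T * LinearMap.mulRight ℂ (adjoint T)) + 1 :
        Module.End ℂ (H →L[ℂ] H)) ^ j) G := by
    intro j
    induction j with
    | zero => rfl
    | succ j ih =>
      rw [Function.iterate_succ_apply', ih, pow_succ']
      simp [defectMap, mul_assoc, sub_eq_neg_add]
  have hc : Commute (LinearMap.mulLeft ℂ T) (LinearMap.mulRight ℂ (adjoint T)) :=
    LinearMap.ext fun X => by simp [mul_assoc]
  rw [h0, (Commute.one_right _).add_pow]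
  simp only [one_pow, mul_one, invKernel, Finset.sum_mul, LinearMap.sum_apply]
  refine Finset.sum_congr rfl fun k _ => ?_
  rw [smul_pow, hc.mul_pow, LinearMap.pow_mulLeft, LinearMap.pow_mulRight]
  have h3 : G * adjoint T ^ k = adjoint T ^ k * G := (h2.pow_left k).eq.symm
  have h5 : ∀ (c : ℕ) (A : Module.End ℂ (H →L[ℂ] H)), (A * (c : Module.End ℂ (H →L[ℂ] H))) G
      = (c : ℂ) • A G := by
    intro c A
    simp [Module.End.mul_apply, Module.End.natCast_apply, ← Nat.cast_smul_eq_nsmul ℂ]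
  rw [h5]
  simp [h3, smul_smul, mul_assoc, mul_comm]

lemma tendsto_inner_pow_adjoint {T : H →L[ℂ] H} (hT : IsPure T) (X : H →L[ℂ] H) (h : H) :
    Filter.Tendsto (fun k : ℕ => ⟪X ((adjoint T ^ k) h), (adjoint T ^ k) h⟫_ℂ)
      Filter.atTop (nhds 0) := by
  simpa using ((X.continuous.tendsto _).comp (hT h)).inner (𝕜 := ℂ) (hT h)

lemma inner_defectMap (T X : H →L[ℂ] H) (h : H) (k : ℕ) :
    ⟪defectMap T X ((adjoint T ^ k) h), (adjoint T ^ k) h⟫_ℂ =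
      ⟪X ((adjoint T ^ k) h), (adjoint T ^ k) h⟫_ℂ -
        ⟪X ((adjoint T ^ (k + 1)) h), (adjoint T ^ (k + 1)) h⟫_ℂ := by
  rw [defectMap, sub_apply, inner_sub_left, pow_succ']
  simp [← adjoint_inner_right]

/-- For a pure operator `T`, an operator `X` is recovered from its positive `m`-fold defect. -/
theorem hasSum_choose_mul_inner_defectMap (m : ℕ+) {T : H →L[ℂ] H} (hT : IsPure T)
    {X : H →L[ℂ] H} (hX : ((defectMap T)^[m] X).IsPositive) (h : H) :
    HasSum (fun k : ℕ => (((m : ℕ) + k - 1).choose k : ℂ) *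
      ⟪(defectMap T)^[m] X ((adjoint T ^ k) h), (adjoint T ^ k) h⟫_ℂ) ⟪X h, h⟫_ℂ := by
  obtain ⟨p, hp⟩ : ∃ p, (m : ℕ) = p + 1 := ⟨m - 1, by have := m.pos; omega⟩
  rw [hp] at hX ⊢
  set b : ℕ → ℕ → ℂ := fun j k =>
    ⟪(defectMap T)^[j] X ((adjoint T ^ k) h), (adjoint T ^ k) h⟫_ℂ with hb
  have hstep : ∀ j k, b (j + 1) k = b j k - b j (k + 1) := fun j k => by
    simp only [hb, Function.iterate_succ_apply', inner_defectMap]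
  have hlim : ∀ j, Filter.Tendsto (b j) Filter.atTop (nhds 0) :=
    fun j => tendsto_inner_pow_adjoint hT _ h
  have hpos : ∀ k, 0 ≤ (b (p + 1) k).re ∧ (b (p + 1) k).im = 0 := fun k => by
    have := hX.inner_nonneg_left ((adjoint T ^ k) h)
    rw [Complex.le_def] at this
    exact ⟨this.1, this.2.symm⟩
  have hre := hasSum_choose_mul_difference p (a := fun j k => (b j k).re)
    (fun j k => by simp [hstep]) (fun j => by
      simpa [Function.comp_def] using (Complex.continuous_re.tendsto _).comp (hlim j))
    (fun k => (hpos k).1)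
  have him := hasSum_choose_mul_difference p (a := fun j k => (b j k).im)
    (fun j k => by simp [hstep]) (fun j => by
      simpa [Function.comp_def] using (Complex.continuous_im.tendsto _).comp (hlim j))
    (fun k => (hpos k).2.ge)
  have h0 : b 0 0 = ⟪X h, h⟫_ℂ := by simp [hb]
  rw [← h0, Complex.hasSum_iff]
  constructor
  · convert! hre using 2 with k
    simp [hb, show p + 1 + k - 1 = p + k by omega, ← Complex.ofReal_natCast]
  · convert! him using 2 with k
    simp [hb, show p + 1 + k - 1 = p + k by omega, ← Complex.ofReal_natCast]

open scoped ComplexOrder in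
/-- For a pure operator `T`, an operator with a positive `m`-fold defect is positive. -/
theorem isPositive_of_defectMap (m : ℕ+) {T : H →L[ℂ] H} (hT : IsPure T)
    {X : H →L[ℂ] H} (hX : ((defectMap T)^[m] X).IsPositive) : X.IsPositive := by
  rw [isPositive_iff_complex]
  intro h
  have h1 : 0 ≤ ⟪X h, h⟫_ℂ := (hasSum_choose_mul_inner_defectMap m hT hX h).nonneg fun k =>
    mul_nonneg (by exact_mod_cast Nat.zero_le _) (hX.inner_nonneg_left _)
  rw [Complex.le_def] at h1
  exact ⟨Complex.ext (by simp) (by simpa using h1.2), h1.1⟩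

/-! ### Coefficients in weighted Bergman spaces -/

namespace Bergman

variable {n : ℕ} {m : Fin n → ℕ+}
variable {F : Type*} [NormedAddCommGroup F]

lemma hasSum_norm_sq (f : Bergman m F) : HasSum (fun k => ‖coeff f k‖ ^ 2) (‖f‖ ^ 2) := by
  rw [norm_sq_eq_tsum]
  exact (summable_norm_coeff_sq f).hasSum

lemma coeff_sub (f g : Bergman m F) (k : Fin n → ℕ) :
    coeff (f - g) k = coeff f k - coeff g k := rfl

/-- The element of `A²_m(F)` whose only nonzero coefficient is `x`, at the exponent `k`. -/
def single (m : Fin n → ℕ+) (k : Fin n → ℕ) (x : F) : Bergman m F :=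
  mk (Pi.single k x) (summable_of_ne_finset_zero (s := {k}) fun j hj => by
    rw [Pi.single_eq_of_ne (by simpa using hj)]; simp)

lemma coeff_single (k j : Fin n → ℕ) (x : F) :
    coeff (single m k x) j = if j = k then x else 0 := by
  rw [single, coeff_mk, Pi.single_apply]

lemma norm_mk_sq {a : (Fin n → ℕ) → F} (ha : Summable fun k => ‖a k‖ ^ 2) {s : ℝ}
    (h : HasSum (fun k => ‖a k‖ ^ 2) s) : ‖(mk a ha : Bergman m F)‖ ^ 2 = s :=
  (hasSum_norm_sq (mk a ha : Bergman m F)).unique h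

variable [InnerProductSpace ℂ F]
variable {K : Type*} [NormedAddCommGroup K] [InnerProductSpace ℂ K]

/-- The bounded operator `f ↦ coeff f k`. -/
def coeffCLM (m : Fin n → ℕ+) (F : Type*) [NormedAddCommGroup F] [InnerProductSpace ℂ F]
    (k : Fin n → ℕ) : Bergman m F →L[ℂ] F :=
  LinearMap.mkContinuous
    { toFun := fun f => coeff f k
      map_add' := fun f g => coeff_add f g k
      map_smul' := fun c f => coeff_smul c f k } 1 (fun f => by
        rw [one_mul]
        exact (abs_le_of_sq_le_sq' (le_hasSum (hasSum_norm_sq f) k fun j _ => sq_nonneg _)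
          (norm_nonneg _)).2)

@[simp] lemma coeffCLM_apply (f : Bergman m F) (k : Fin n → ℕ) :
    coeffCLM m F k f = coeff f k := rfl

lemma norm_coeffCLM_le (k : Fin n → ℕ) : ‖coeffCLM m F k‖ ≤ 1 :=
  LinearMap.mkContinuous_norm_le _ zero_le_one _

lemma inner_single (f : Bergman m F) (k : Fin n → ℕ) (x : F) :
    ⟪f, single m k x⟫_ℂ = ⟪coeff f k, x⟫_ℂ := by
  refine (hasSum_inner f _).unique ?_
  convert! hasSum_single k (f := fun j => ⟪coeff f j, coeff (single m k x) j⟫_ℂ) ?_ using 2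
  · simp [coeff_single]
  · intro j hj
    simp [coeff_single, hj]

/-- Bounded operators on `A²_m(F)` are determined by their values on the elements with a single
nonzero coefficient, taken from a dense subset of `F`. -/
lemma clm_ext_single [CompleteSpace F] [CompleteSpace K] {ι : Type*} {d : ι → F}
    (hd : DenseRange d) {A B : Bergman m F →L[ℂ] K}
    (h : ∀ k y, A (single m k (d y)) = B (single m k (d y))) : A = B := by
  refine (adjoint (𝕜 := ℂ)).injective (ContinuousLinearMap.ext fun v => ext_coeff fun k => ?_)
  refine hd.eq_of_inner_left ℂ fun y => ?_
  rw [← inner_single, ← inner_single, adjoint_inner_left, adjoint_inner_left, h]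

/-- The bounded operator into `A²_m(F)` with the given coefficient operators. -/
def ofCoeff (m : Fin n → ℕ+) (A : (Fin n → ℕ) → K →L[ℂ] F) (C : ℝ)
    (hA : ∀ x, ∃ s ≤ (C * ‖x‖) ^ 2, HasSum (fun k => ‖A k x‖ ^ 2) s) (hC : 0 ≤ C) :
    K →L[ℂ] Bergman m F :=
  LinearMap.mkContinuous
    { toFun := fun x => mk (fun k => A k x) (hA x).choose_spec.2.summable
      map_add' := fun x y => ext_coeff fun k => by simp [coeff_add]
      map_smul' := fun c x => ext_coeff fun k => by simp [coeff_smul] } C (fun x => by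
    obtain ⟨s, hs, h⟩ := hA x
    have h1 : ‖(mk (fun k => A k x) h.summable : Bergman m F)‖ ^ 2 ≤ (C * ‖x‖) ^ 2 :=
      (norm_mk_sq h.summable h).trans_le hs
    exact (abs_le_of_sq_le_sq' h1 (by positivity)).2)

@[simp] lemma coeff_ofCoeff (A : (Fin n → ℕ) → K →L[ℂ] F) {C : ℝ}
    (hA : ∀ x, ∃ s ≤ (C * ‖x‖) ^ 2, HasSum (fun k => ‖A k x‖ ^ 2) s) (hC : 0 ≤ C) (x : K)
    (k : Fin n → ℕ) : coeff (ofCoeff m A C hA hC x) k = A k x := rfl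

lemma norm_ofCoeff_le (A : (Fin n → ℕ) → K →L[ℂ] F) {C : ℝ}
    (hA : ∀ x, ∃ s ≤ (C * ‖x‖) ^ 2, HasSum (fun k => ‖A k x‖ ^ 2) s) (hC : 0 ≤ C) :
    ‖ofCoeff m A C hA hC‖ ≤ C :=
  LinearMap.mkContinuous_norm_le _ hC _

/-- A family of operators whose squared norms sum up to the quadratic form of `G` is the family
of coefficients of an operator `V` with `V* V = G`. -/
lemma exists_coeff_eq [CompleteSpace F] [CompleteSpace K] (m : Fin n → ℕ+)
    (A : (Fin n → ℕ) → K →L[ℂ] F) (G : K →L[ℂ] K)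
    (hA : ∀ h, HasSum (fun k => ((‖A k h‖ ^ 2 : ℝ) : ℂ)) ⟪G h, h⟫_ℂ) :
    ∃ V : K →L[ℂ] Bergman m F, (∀ h k, coeff (V h) k = A k h) ∧
      ∀ x y, ⟪V x, V y⟫_ℂ = ⟪G x, y⟫_ℂ := by
  have hs : ∀ h, HasSum (fun k => ‖A k h‖ ^ 2) (⟪G h, h⟫_ℂ).re := fun h => by
    simpa only [Complex.ofReal_re] using ((Complex.hasSum_iff _ _).1 (hA h)).1
  have hb : ∀ h, ∃ s ≤ (Real.sqrt ‖G‖ * ‖h‖) ^ 2, HasSum (fun k => ‖A k h‖ ^ 2) s := fun h => by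
    refine ⟨_, ?_, hs h⟩
    rw [mul_pow, Real.sq_sqrt (norm_nonneg _)]
    refine (Complex.re_le_norm _).trans ((norm_inner_le_norm _ _).trans ?_)
    rw [sq, ← mul_assoc]
    exact mul_le_mul_of_nonneg_right (G.le_opNorm h) (norm_nonneg _)
  refine ⟨ofCoeff m A _ hb (Real.sqrt_nonneg _), fun h k => rfl, ?_⟩
  set V := ofCoeff m A _ hb (Real.sqrt_nonneg _) with hV
  have h1 : ((adjoint V ∘L V : K →L[ℂ] K) : K →ₗ[ℂ] K) = G := by
    rw [← ext_inner_map]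
    intro h
    have h2 : ⟪V h, V h⟫_ℂ = ⟪G h, h⟫_ℂ := by
      refine (hasSum_inner (V h) (V h)).unique ?_
      convert! hA h using 2 with k
      simp [hV]
    simpa [adjoint_inner_left] using h2
  intro x y
  rw [← adjoint_inner_left]
  exact congrArg (fun B : K →ₗ[ℂ] K => ⟪B x, y⟫_ℂ) h1

/-! ### The backward shift -/

lemma sqrt_kernelCoeff_ne_zero (m : Fin n → ℕ+) (k : Fin n → ℕ) :
    (Real.sqrt (kernelCoeff m k) : ℂ) ≠ 0 := by
  have := kernelCoeff_pos m k
  exact_mod_cast (Real.sqrt_pos.2 (by exact_mod_cast this)).ne'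

lemma basisMonomial_add_single (m : Fin n → ℕ+) (k : Fin n → ℕ) (i : Fin n) (z : Fin n → ℂ) :
    (Real.sqrt (kernelCoeff m k) : ℂ) * basisMonomial m (k + Pi.single i 1) z =
      (Real.sqrt (kernelCoeff m (k + Pi.single i 1)) : ℂ) * (z i * basisMonomial m k z) := by
  have hp : ∏ j, z j ^ (k + Pi.single i 1 : Fin n → ℕ) j = z i * ∏ j, z j ^ k j := by
    simp only [Pi.add_apply, pow_add, Finset.prod_mul_distrib]
    rw [mul_comm]
    congr 1
    rw [Finset.prod_eq_single i (fun j _ hj => by simp [Pi.single_eq_of_ne hj])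
      (fun h => absurd (Finset.mem_univ i) h)]
    simp
  rw [basisMonomial, basisMonomial, hp]
  ring

/-- The backward shift: the adjoint of multiplication by `zᵢ`, see `adjoint_shift`. -/
def backwardShift (m : Fin n → ℕ+) (F : Type*) [NormedAddCommGroup F] [InnerProductSpace ℂ F]
    (i : Fin n) : Bergman m F →L[ℂ] Bergman m F :=
  ofCoeff m (fun k => ((Real.sqrt (kernelCoeff m k) /
    Real.sqrt (kernelCoeff m (k + Pi.single i 1)) : ℝ) : ℂ) • coeffCLM m F (k + Pi.single i 1)) 1
    (fun f => by
      have hle : ∀ k, ‖(((Real.sqrt (kernelCoeff m k) / Real.sqrt (kernelCoeff m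
          (k + Pi.single i 1)) : ℝ) : ℂ) • coeffCLM m F (k + Pi.single i 1)) f‖ ^ 2 ≤
          ‖coeff f (k + Pi.single i 1)‖ ^ 2 := fun k => by
        have hle : Real.sqrt (kernelCoeff m k) /
            Real.sqrt (kernelCoeff m (k + Pi.single i 1)) ≤ 1 :=
          div_le_one_of_le₀ (Real.sqrt_le_sqrt (by exact_mod_cast kernelCoeff_le m k i))
            (Real.sqrt_nonneg _)
        rw [smul_apply, norm_smul, Complex.norm_real, Real.norm_eq_abs,
          abs_of_nonneg (by positivity)]
        gcongr
        exact mul_le_of_le_one_left (norm_nonneg _) hle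
      have hinj : Function.Injective fun k : Fin n → ℕ => k + Pi.single i 1 :=
        add_left_injective _
      have hs : Summable fun k => ‖coeff f (k + Pi.single i 1)‖ ^ 2 :=
        (summable_norm_coeff_sq f).comp_injective hinj
      have hs' := Summable.of_nonneg_of_le (fun _ => sq_nonneg _) hle hs
      refine ⟨_, ?_, hs'.hasSum⟩
      rw [one_mul, norm_sq_eq_tsum f]
      exact hs'.tsum_le_tsum_of_inj _ hinj (fun _ _ => sq_nonneg _) hle
        (summable_norm_coeff_sq f)) zero_le_one

lemma coeff_backwardShift (i : Fin n) (f : Bergman m F) (k : Fin n → ℕ) :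
    coeff (backwardShift m F i f) k =
      ((Real.sqrt (kernelCoeff m k) / Real.sqrt (kernelCoeff m (k + Pi.single i 1)) : ℝ) : ℂ) •
        coeff f (k + Pi.single i 1) := rfl

lemma norm_backwardShift_le (i : Fin n) : ‖backwardShift m F i‖ ≤ 1 :=
  norm_ofCoeff_le _ _ _

variable [CompleteSpace F]

lemma backwardShift_kerFun (i : Fin n) (z : polydisc n) (v : F) :
    backwardShift m F i (RKHS.kerFun (Bergman m F) z v) =
      conj ((z : Fin n → ℂ) i) • RKHS.kerFun (Bergman m F) z v := by
  refine ext_coeff fun k => ?_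
  rw [coeff_backwardShift, coeff_smul, coeff_kerFun, coeff_kerFun, smul_smul, smul_smul]
  congr 1
  have h := congrArg conj (basisMonomial_add_single m k i (z : Fin n → ℂ))
  have h0 := sqrt_kernelCoeff_ne_zero m (k + Pi.single i 1)
  simp only [map_mul, Complex.conj_ofReal] at h
  rw [Complex.ofReal_div]
  field_simp
  linear_combination h

lemma backwardShift_pow_kerFun (i : Fin n) (z : polydisc n) (v : F) (l : ℕ) :
    (backwardShift m F i ^ l) (RKHS.kerFun (Bergman m F) z v) =
      conj ((z : Fin n → ℂ) i) ^ l • RKHS.kerFun (Bergman m F) z v := by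
  induction l with
  | zero => simp
  | succ l ih =>
    rw [pow_succ', mul_apply_eq_comp, ih, map_smul, backwardShift_kerFun, smul_smul, pow_succ]

theorem adjoint_shift (i : Fin n) : adjoint (shift m F i) = backwardShift m F i := by
  rw [eq_comm, ← adjoint_adjoint (backwardShift m F i)]
  congr 1
  refine ContinuousLinearMap.ext fun f => RKHS.ext fun z => ext_inner_left ℂ fun v => ?_
  rw [← RKHS.kerFun_inner, adjoint_inner_right, backwardShift_kerFun, inner_smul_left,
    RKHS.kerFun_inner, shift_apply, inner_smul_right]
  simp

/-- The kernel functions are eigenvectors of the adjoint shift for the eigenvalues `conj zᵢ`,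
and their span is dense, so that the powers of the adjoint shift, which are contractions, tend to
zero strongly. -/
theorem isPure_shift (i : Fin n) : IsPure (shift m F i) := by
  intro f
  rw [adjoint_shift]
  set B := backwardShift m F i with hB
  have hpow : ∀ (l : ℕ) (g : Bergman m F), ‖(B ^ l) g‖ ≤ ‖g‖ := fun l g => by
    induction l with
    | zero => simp
    | succ l ih =>
      rw [pow_succ']
      exact (B.le_of_opNorm_le (norm_backwardShift_le i) _).trans (by rwa [one_mul])
  have hspan : ∀ g ∈ Submodule.span ℂ {RKHS.kerFun (Bergman m F) x v | (x) (v)},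
      Filter.Tendsto (fun l : ℕ => (B ^ l) g) Filter.atTop (nhds 0) := fun g hg => by
    induction hg using Submodule.span_induction with
    | mem g hg =>
      obtain ⟨z, v, rfl⟩ := hg
      simp only [hB, backwardShift_pow_kerFun]
      have h2 := tendsto_pow_atTop_nhds_zero_of_norm_lt_one
        (x := conj ((z : Fin n → ℂ) i)) (by rw [RCLike.norm_conj]; exact z.2 i)
      simpa using h2.smul_const (RKHS.kerFun (Bergman m F) z v)
    | zero => simp
    | add x y _ _ hx hy => simpa using hx.add hy
    | smul c x _ hx => simpa using hx.const_smul c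
  have hf : f ∈ closure (Submodule.span ℂ {RKHS.kerFun (Bergman m F) x v | (x) (v)} :
      Set (Bergman m F)) := by
    rw [← Submodule.topologicalClosure_coe, RKHS.kerFun_dense]
    trivial
  rw [Metric.tendsto_atTop]
  intro ε hε
  obtain ⟨g, hg, hfg⟩ := Metric.mem_closure_iff.1 hf (ε / 2) (half_pos hε)
  obtain ⟨N, hN⟩ := Metric.tendsto_atTop.1 (hspan g hg) (ε / 2) (half_pos hε)
  refine ⟨N, fun l hl => ?_⟩
  have h1 := hN l hl
  have h2 := hpow l (f - g)
  rw [dist_zero_right] at h1 ⊢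
  rw [dist_eq_norm] at hfg
  have h3 : (B ^ l) f = (B ^ l) (f - g) + (B ^ l) g := by rw [map_sub]; abel
  rw [h3]
  exact (norm_add_le _ _).trans_lt (by linarith)

end Bergman

section
variable {n : ℕ} {m₁ m₂ : Fin n → ℕ+}
variable {E₁ E₂ : Type*} [NormedAddCommGroup E₁] [InnerProductSpace ℂ E₁] [CompleteSpace E₁]
  [NormedAddCommGroup E₂] [InnerProductSpace ℂ E₂] [CompleteSpace E₂]

/-- A bounded operator whose adjoint maps `k_z v` to `k_z (Θ(z)* v)` is multiplication by `Θ`. -/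
lemma apply_of_adjoint_kerFun {A : Bergman m₁ E₁ →L[ℂ] Bergman m₂ E₂}
    {Θ : (Fin n → ℂ) → E₁ →L[ℂ] E₂}
    (h : ∀ (z : polydisc n) v, adjoint A (RKHS.kerFun (Bergman m₂ E₂) z v) =
      RKHS.kerFun (Bergman m₁ E₁) z (adjoint (Θ z) v)) (f : Bergman m₁ E₁) (z : polydisc n) :
    A f z = Θ z (f z) := by
  refine ext_inner_left ℂ fun v => ?_
  rw [← RKHS.kerFun_inner, ← adjoint_inner_left, h, RKHS.kerFun_inner, adjoint_inner_left]

lemma IsMultiplier.mulOp_eq {Θ : (Fin n → ℂ) → E₁ →L[ℂ] E₂} (hΘ : IsMultiplier m₁ m₂ Θ)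
    {A : Bergman m₁ E₁ →L[ℂ] Bergman m₂ E₂} (h : ∀ f (z : polydisc n), A f z = Θ z (f z)) :
    hΘ.mulOp = A :=
  ContinuousLinearMap.ext fun f => RKHS.ext fun z => by rw [hΘ.mulOp_apply, h]

end

section

variable {K₁ K₂ : Type*} [NormedAddCommGroup K₁] [InnerProductSpace ℂ K₁] [CompleteSpace K₁]
  [NormedAddCommGroup K₂] [InnerProductSpace ℂ K₂] [CompleteSpace K₂]

/-! ### Operators with a projection as Gram operator -/

lemma inner_sqrt {X : K₁ →L[ℂ] K₁} (hX : X.IsPositive) (x y : K₁) :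
    ⟪CFC.sqrt X x, CFC.sqrt X y⟫_ℂ = ⟪X x, y⟫_ℂ := by
  have h0 : 0 ≤ X := (nonneg_iff_isPositive X).2 hX
  have h1 : IsSelfAdjoint (CFC.sqrt X) := (CFC.sqrt_nonneg X).isSelfAdjoint
  rw [← adjoint_inner_left, h1.adjoint_eq, ← mul_apply_eq_comp, CFC.sqrt_mul_sqrt_self X h0]

variable {W : K₁ →L[ℂ] K₂} {P : K₁ →L[ℂ] K₁}

lemma isPartialIsometry_adjoint_of_gram (hP : IsStarProjection P)
    (hW : ∀ x y, ⟪W x, W y⟫_ℂ = ⟪P x, y⟫_ℂ) : IsPartialIsometry (adjoint W) := by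
  have hPP : ∀ x y, ⟪P x, y⟫_ℂ = ⟪P x, P y⟫_ℂ := fun x y => by
    rw [← adjoint_inner_left P, hP.isSelfAdjoint.adjoint_eq, ← mul_apply_eq_comp,
      hP.isIdempotentElem.eq]
  have hAW : ∀ x, adjoint W (W x) = P x := fun x => ext_inner_right ℂ fun y => by
    rw [adjoint_inner_left, hW]
  intro x hx
  rw [ContinuousLinearMap.orthogonal_ker, adjoint_adjoint] at hx
  have hc : IsClosed {x : K₂ | ‖adjoint W x‖ = ‖x‖} :=
    isClosed_eq (by fun_prop) continuous_norm
  refine closure_minimal ?_ hc hx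
  rintro _ ⟨y, rfl⟩
  simp only [Set.mem_ofPred_eq, coe_coe, hAW]
  have h1 : ⟪P y, P y⟫_ℂ = ⟪W y, W y⟫_ℂ := by rw [hW, ← hPP]
  rw [inner_self_eq_norm_sq_to_K, inner_self_eq_norm_sq_to_K] at h1
  have h2 : ‖P y‖ ^ 2 = ‖W y‖ ^ 2 := by exact_mod_cast h1
  exact (sq_eq_sq₀ (norm_nonneg _) (norm_nonneg _)).1 h2

lemma range_adjoint_of_gram (hP : IsStarProjection P)
    (hW : ∀ x y, ⟪W x, W y⟫_ℂ = ⟪P x, y⟫_ℂ) :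
    LinearMap.range (adjoint W : K₂ →ₗ[ℂ] K₁) = LinearMap.range (P : K₁ →ₗ[ℂ] K₁) := by
  refine le_antisymm ?_ ?_
  · rintro _ ⟨y, rfl⟩
    refine ⟨adjoint W y, ?_⟩
    have h1 : ∀ x, W (P x) = W x := fun x => by
      rw [← sub_eq_zero, ← map_sub, ← inner_self_eq_zero (𝕜 := ℂ), hW, map_sub,
        ← mul_apply_eq_comp, hP.isIdempotentElem.eq, sub_self, inner_zero_left]
    refine ext_inner_right ℂ fun x => ?_
    simp only [coe_coe]
    rw [← adjoint_inner_right P, hP.isSelfAdjoint.adjoint_eq, adjoint_inner_left, h1,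
      adjoint_inner_left]
  · rintro _ ⟨x, rfl⟩
    refine ⟨W x, ext_inner_right ℂ fun y => ?_⟩
    simp only [coe_coe]
    rw [adjoint_inner_left, hW]

end

section OneVariable

variable {H : Type*} [NormedAddCommGroup H] [InnerProductSpace ℂ H] [CompleteSpace H]
variable {F : Type*} [NormedAddCommGroup F] [InnerProductSpace ℂ F]
variable {K : Type*} [NormedAddCommGroup K] [InnerProductSpace ℂ K]

/-! ### Multipliers in one variable and invariant subspaces -/

/-- The operators `x ↦ (B x)(w)`, as a power series in `w`. -/
def evalSeries (p : ℕ+) (B : K →L[ℂ] Bergman (fun _ : Fin 1 => p) F) (w : ℂ) : K →L[ℂ] F :=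
  ∑' k : Fin 1 → ℕ, basisMonomial (fun _ : Fin 1 => p) k (fun _ => w) •
    (Bergman.coeffCLM (fun _ : Fin 1 => p) F k ∘L B)

lemma norm_evalSeries_term_le (p : ℕ+) (B : K →L[ℂ] Bergman (fun _ : Fin 1 => p) F)
    {w : ℂ} {r : ℝ} (hw : ‖w‖ ≤ r) (k : Fin 1 → ℕ) :
    ‖basisMonomial (fun _ : Fin 1 => p) k (fun _ => w) •
      (Bergman.coeffCLM (fun _ : Fin 1 => p) F k ∘L B)‖ ≤
      (kernelCoeff (fun _ : Fin 1 => p) k * ∏ i, r ^ k i) * ‖B‖ := by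
  have hr : 0 ≤ r := (norm_nonneg w).trans hw
  rw [norm_smul]
  refine mul_le_mul ?_ ?_ (norm_nonneg _) (by positivity)
  · rw [basisMonomial, norm_mul, norm_prod, Complex.norm_real, Real.norm_eq_abs,
      abs_of_nonneg (Real.sqrt_nonneg _)]
    refine mul_le_mul ?_ ?_ (by positivity) (by positivity)
    -- As `1 ≤ c`, the square root of the kernel coefficient `c` is at most `c`.
    · have h1 : (1 : ℝ) ≤ kernelCoeff (fun _ : Fin 1 => p) k := by
        exact_mod_cast kernelCoeff_pos (fun _ : Fin 1 => p) k
      rw [Real.sqrt_le_left (by positivity)]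
      nlinarith
    · refine Finset.prod_le_prod (fun i _ => norm_nonneg _) fun i _ => ?_
      rw [norm_pow]
      gcongr
  · refine (opNorm_comp_le _ _).trans (mul_le_of_le_one_left (norm_nonneg _) ?_)
    exact Bergman.norm_coeffCLM_le k

lemma summable_evalSeries_bound (p : ℕ+) (C : ℝ) {r : ℝ} (hr : 0 ≤ r) (hr1 : r < 1) :
    Summable fun k : Fin 1 → ℕ =>
      (kernelCoeff (fun _ : Fin 1 => p) k * ∏ i, r ^ k i : ℝ) * C := by
  have h := (hasSum_kernelCoeff (fun _ : Fin 1 => p) (fun _ => (r : ℂ)) fun _ => by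
    rwa [Complex.norm_real, Real.norm_eq_abs, abs_of_nonneg hr]).summable
  refine Summable.mul_right C ?_
  exact_mod_cast h

variable [CompleteSpace F]

/-- The operator `h ↦ ∑ₖ C(p + k - 1, k) zᵏ D T*ᵏ h` into the weighted Bergman space over the
disc, where `D* D` is the `p`-fold defect of `X`. -/
lemma exists_oneVar_gram (p : ℕ+) {T : H →L[ℂ] H} (hT : IsPure T) {X : H →L[ℂ] H}
    (hX : ((defectMap T)^[p] X).IsPositive) (D : H →L[ℂ] F)
    (hD : ∀ x y, ⟪D x, D y⟫_ℂ = ⟪(defectMap T)^[p] X x, y⟫_ℂ) :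
    ∃ W : H →L[ℂ] Bergman (fun _ : Fin 1 => p) F,
      (∀ h k, Bergman.coeff (W h) k =
        (Real.sqrt (kernelCoeff (fun _ : Fin 1 => p) k) : ℂ) • D ((adjoint T ^ k 0) h)) ∧
      ∀ x y, ⟪W x, W y⟫_ℂ = ⟪X x, y⟫_ℂ := by
  refine Bergman.exists_coeff_eq (fun _ : Fin 1 => p) (fun k =>
    (Real.sqrt (kernelCoeff (fun _ : Fin 1 => p) k) : ℂ) • (D ∘L (adjoint T ^ k 0))) X fun h => ?_
  rw [← (Equiv.funUnique (Fin 1) ℕ).symm.hasSum_iff]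
  convert! hasSum_choose_mul_inner_defectMap p hT hX h using 2 with k
  simp only [Function.comp_apply]
  rw [← hD, inner_self_eq_norm_sq_to_K]
  simp [norm_smul, mul_pow, kernelCoeff, Equiv.funUnique]

lemma differentiableOn_evalSeries (p : ℕ+) (B : K →L[ℂ] Bergman (fun _ : Fin 1 => p) F) :
    DifferentiableOn ℂ (evalSeries p B) (Metric.ball 0 1) := by
  intro w hw
  obtain ⟨r, hwr, hr1⟩ := exists_between (mem_ball_zero_iff.1 hw)
  have hr : 0 ≤ r := (norm_nonneg w).trans hwr.le
  have h := Complex.differentiableOn_tsum_of_summable_norm (U := Metric.ball (0 : ℂ) r)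
    (F := fun (k : Fin 1 → ℕ) w => basisMonomial (fun _ : Fin 1 => p) k (fun _ => w) •
      (Bergman.coeffCLM (fun _ : Fin 1 => p) F k ∘L B))
    (summable_evalSeries_bound p ‖B‖ hr hr1)
    (fun k => by unfold basisMonomial; fun_prop) Metric.isOpen_ball
    (fun k w hw => norm_evalSeries_term_le p B (mem_ball_zero_iff.1 hw).le k)
  exact ((h w (mem_ball_zero_iff.2 hwr)).differentiableAt
    (Metric.isOpen_ball.mem_nhds (mem_ball_zero_iff.2 hwr))).differentiableWithinAt

lemma evalSeries_apply (p : ℕ+) (B : K →L[ℂ] Bergman (fun _ : Fin 1 => p) F) (z : polydisc 1)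
    (x : K) : evalSeries p B ((z : Fin 1 → ℂ) 0) x = B x z := by
  have hz : (fun _ => (z : Fin 1 → ℂ) 0) = (z : Fin 1 → ℂ) :=
    funext fun i => by rw [Subsingleton.elim i 0]
  have hs : Summable fun k : Fin 1 → ℕ =>
      basisMonomial (fun _ : Fin 1 => p) k (fun _ => (z : Fin 1 → ℂ) 0) •
        (Bergman.coeffCLM (fun _ : Fin 1 => p) F k ∘L B) :=
    Summable.of_norm_bounded (summable_evalSeries_bound p ‖B‖ (norm_nonneg _) (z.2 0))
      fun k => norm_evalSeries_term_le p B le_rfl k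
  have h := hs.hasSum.mapL (ContinuousLinearMap.apply ℂ F x)
  refine HasSum.unique ?_ (Bergman.hasSum_apply (B x) z)
  simpa [hz, evalSeries] using h

/-- A Beurling type theorem: if the projection onto `S` is `P` and `S` is invariant under
multiplication by `z` then `P - M_z P M_z*` is positive, and its square root `L` gives the
holomorphic function `θ(w) x = (L x)(w)`. The multiplication operator of `θ` is the adjoint of `W`
and has range `S`. -/
theorem exists_beurling (p : ℕ+) (S : Submodule ℂ (Bergman (fun _ : Fin 1 => p) F))
    [S.HasOrthogonalProjection] (hS : ∀ f ∈ S, shift (fun _ : Fin 1 => p) F 0 f ∈ S) :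
    ∃ (θ : ℂ → Bergman (fun _ : Fin 1 => p) F →L[ℂ] F)
      (W : Bergman (fun _ : Fin 1 => p) F →L[ℂ]
        Bergman (fun _ : Fin 1 => 1) (Bergman (fun _ : Fin 1 => p) F)),
      DifferentiableOn ℂ θ (Metric.ball 0 1) ∧
      (∀ (z : polydisc 1) v, W (RKHS.kerFun (Bergman (fun _ : Fin 1 => p) F) z v) =
        RKHS.kerFun (Bergman (fun _ : Fin 1 => 1) (Bergman (fun _ : Fin 1 => p) F)) z
          (adjoint (θ ((z : Fin 1 → ℂ) 0)) v)) ∧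
      ∀ f g, ⟪W f, W g⟫_ℂ = ⟪S.starProjection f, g⟫_ℂ := by
  set M := shift (fun _ : Fin 1 => p) F 0 with hM
  set P := S.starProjection with hP
  have hPs : IsStarProjection P := isStarProjection_starProjection
  have hMle : ‖adjoint M‖ ≤ 1 := by
    rw [hM, Bergman.adjoint_shift]; exact Bergman.norm_backwardShift_le 0
  have hPin : ∀ f g, ⟪P f, g⟫_ℂ = ⟪f, P g⟫_ℂ := fun f g => by
    rw [← adjoint_inner_left P, hPs.isSelfAdjoint.adjoint_eq]
  have hPP : ∀ f, P (P f) = P f := fun f => by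
    rw [← mul_apply_eq_comp, hPs.isIdempotentElem.eq]
  -- The invariance of `S` in the form `P M* = P M* P`.
  have hinv : ∀ f, P (adjoint M f) = P (adjoint M (P f)) := fun f => by
    refine ext_inner_right ℂ fun g => ?_
    rw [hPin, hPin, adjoint_inner_left, adjoint_inner_left, hPin]
    congr 1
    exact (Submodule.starProjection_eq_self_iff.2
      (hS _ (Submodule.starProjection_apply_mem S g))).symm
  -- By `hinv` the quadratic form of `P - M P M*` is `‖P f‖² - ‖P M* P f‖²`, and `M*` is a
  -- contraction.
  have hpos : (defectMap M P).IsPositive := by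
    rw [isPositive_def']
    refine ⟨hPs.isSelfAdjoint.sub ?_, fun f => ?_⟩
    · exact hPs.isSelfAdjoint.conj_adjoint M
    · have h1 : ⟪defectMap M P f, f⟫_ℂ =
          ⟪P f, P f⟫_ℂ - ⟪P (adjoint M (P f)), P (adjoint M (P f))⟫_ℂ := by
        rw [← hinv, ← hPin, ← hPin, hPP, hPP, defectMap, sub_apply, inner_sub_left,
          mul_apply_eq_comp, mul_apply_eq_comp, ← adjoint_inner_right M]
      have h2 : ‖P (adjoint M (P f))‖ ≤ ‖P f‖ :=
        (S.norm_starProjection_apply_le _).trans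
          ((le_of_opNorm_le _ hMle _).trans_eq (one_mul _))
      rw [reApplyInnerSelf_apply, h1, inner_self_eq_norm_sq_to_K, inner_self_eq_norm_sq_to_K]
      have h3 : ‖P (adjoint M (P f))‖ ^ 2 ≤ ‖P f‖ ^ 2 := by gcongr
      have h4 : 0 ≤ ‖P f‖ ^ 2 - ‖P (adjoint M (P f))‖ ^ 2 := sub_nonneg.2 h3
      exact_mod_cast h4
  set L := CFC.sqrt (defectMap M P) with hL
  have hLs : adjoint L = L := ((CFC.sqrt_nonneg _).isSelfAdjoint : IsSelfAdjoint L).adjoint_eq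
  -- The reproducing formula for the `1`-fold defect, which is why the domain is the Hardy space.
  obtain ⟨W, hW1, hW2⟩ := exists_oneVar_gram 1 (Bergman.isPure_shift (0 : Fin 1)) (X := P) hpos L
    (fun x y => inner_sqrt hpos x y)
  refine ⟨evalSeries p L, W, differentiableOn_evalSeries p L, fun z v => ?_, hW2⟩
  have hθ : adjoint (evalSeries p L ((z : Fin 1 → ℂ) 0)) v =
      L (RKHS.kerFun (Bergman (fun _ : Fin 1 => p) F) z v) := by
    refine ext_inner_right ℂ fun x => ?_
    rw [adjoint_inner_left, evalSeries_apply, ← RKHS.kerFun_inner, ← adjoint_inner_left L, hLs]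
  have hpow : ∀ l : ℕ, (adjoint M ^ l) (RKHS.kerFun (Bergman (fun _ : Fin 1 => p) F) z v) =
      conj ((z : Fin 1 → ℂ) 0) ^ l • RKHS.kerFun (Bergman (fun _ : Fin 1 => p) F) z v := by
    rw [hM, Bergman.adjoint_shift]
    exact Bergman.backwardShift_pow_kerFun 0 z v
  refine Bergman.ext_coeff fun k => ?_
  rw [hW1, hpow, hθ, Bergman.coeff_kerFun, map_smul, smul_smul]
  simp [basisMonomial]

end OneVariable

/-! ### Ampliation of one-variable operators -/

section Ampliation

namespace Bergman

variable {n : ℕ} {m : Fin n → ℕ+}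
variable {F : Type*} [NormedAddCommGroup F] [InnerProductSpace ℂ F]

/-- The part of `f` with the exponents of `k` outside of `i`, as a function of the `i`-th
variable. It does not depend on `k i`. -/
def slice (p : ℕ+) (i : Fin n) (k : Fin n → ℕ) :
    Bergman m F →L[ℂ] Bergman (fun _ : Fin 1 => p) F :=
  ofCoeff (fun _ : Fin 1 => p) (fun j => coeffCLM m F (Function.update k i (j 0))) 1 (fun f => by
    have hinj : Function.Injective fun j : Fin 1 → ℕ => Function.update k i (j 0) :=
      fun a b h => funext fun x => by
        rw [Subsingleton.elim x 0]; exact Function.update_injective k i h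
    have hs : Summable fun j : Fin 1 → ℕ => ‖coeff f (Function.update k i (j 0))‖ ^ 2 :=
      (summable_norm_coeff_sq f).comp_injective hinj
    refine ⟨_, ?_, hs.hasSum⟩
    rw [one_mul, norm_sq_eq_tsum f]
    exact hs.tsum_le_tsum_of_inj _ hinj (fun _ _ => sq_nonneg _) (fun _ => le_rfl)
      (summable_norm_coeff_sq f)) zero_le_one

@[simp] lemma coeff_slice (p : ℕ+) (i : Fin n) (k : Fin n → ℕ) (f : Bergman m F)
    (j : Fin 1 → ℕ) : coeff (slice p i k f) j = coeff f (Function.update k i (j 0)) := rfl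

@[simp] lemma slice_update (p : ℕ+) (i : Fin n) (k : Fin n → ℕ) (a : ℕ) (f : Bergman m F) :
    slice p i (Function.update k i a) f = slice p i k f :=
  ext_coeff fun j => by simp

lemma eq_of_slice_eq (p : ℕ+) (i : Fin n) {f g : Bergman m F}
    (h : ∀ k, slice p i k f = slice p i k g) : f = g :=
  ext_coeff fun k => by
    have := congrArg (fun f => coeff f fun _ => k i) (h k)
    simpa using this

/-- The exponent that is `0` at `i` and given elsewhere. -/
def extendZero (i : Fin n) (k : {j // j ≠ i} → ℕ) : Fin n → ℕ :=
  (Equiv.funSplitAt i ℕ).symm (0, k)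

/-- Exponents are pairs of the exponents of the other variables and the `i`-th exponent. -/
def splitEquiv (i : Fin n) : ({j // j ≠ i} → ℕ) × (Fin 1 → ℕ) ≃ (Fin n → ℕ) :=
  (Equiv.prodCongr (Equiv.refl _) (Equiv.funUnique (Fin 1) ℕ)).trans
    ((Equiv.prodComm _ _).trans (Equiv.funSplitAt i ℕ).symm)

lemma splitEquiv_apply (i : Fin n) (q : ({j // j ≠ i} → ℕ) × (Fin 1 → ℕ)) :
    splitEquiv i q = Function.update (extendZero i q.1) i (q.2 0) := by
  funext j
  by_cases hj : j = i
  · subst hj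
    simp [splitEquiv, Equiv.funUnique]
  · simp [splitEquiv, extendZero, hj]

lemma hasSum_inner_slice (p : ℕ+) (i : Fin n) (f g : Bergman m F) :
    HasSum (fun k => ⟪slice p i (extendZero i k) f, slice p i (extendZero i k) g⟫_ℂ)
      ⟪f, g⟫_ℂ := by
  have h := hasSum_inner f g
  rw [← (splitEquiv i).hasSum_iff] at h
  refine h.prod_fiberwise fun k => ?_
  simpa [splitEquiv_apply] using
    hasSum_inner (slice p i (extendZero i k) f) (slice p i (extendZero i k) g)

lemma hasSum_norm_slice_sq (p : ℕ+) (i : Fin n) (f : Bergman m F) :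
    HasSum (fun k => ‖slice p i (extendZero i k) f‖ ^ 2) (‖f‖ ^ 2) := by
  have h := hasSum_inner_slice p i f f
  simp only [inner_self_eq_norm_sq_to_K] at h
  exact_mod_cast h

variable {E : Type*} [NormedAddCommGroup E] [InnerProductSpace ℂ E]
variable {p q : ℕ+} {m₁ m₂ m₃ : Fin n → ℕ+}

/-- The operator `A`, acting on functions of the `i`-th variable, as an operator on functions of
all variables. -/
def ampl (m₁ m₂ : Fin n → ℕ+) (i : Fin n)
    (A : Bergman (fun _ : Fin 1 => p) E →L[ℂ] Bergman (fun _ : Fin 1 => q) F) :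
    Bergman m₁ E →L[ℂ] Bergman m₂ F :=
  ofCoeff m₂ (fun k => coeffCLM (fun _ : Fin 1 => q) F (fun _ => k i) ∘L A ∘L slice p i k) ‖A‖
    (fun f => by
      set g : (Fin n → ℕ) → ℝ := fun k =>
        ‖(coeffCLM (fun _ : Fin 1 => q) F (fun _ => k i) ∘L A ∘L slice p i k) f‖ ^ 2 with hg
      have hrow : ∀ k, HasSum (fun j => (g ∘ splitEquiv i) (k, j))
          (‖A (slice p i (extendZero i k) f)‖ ^ 2) := fun k => by
        convert! hasSum_norm_sq (A (slice p i (extendZero i k) f)) using 2 with j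
        simp only [hg, Function.comp_apply, splitEquiv_apply, coe_comp, slice_update,
          Function.update_self, coeffCLM_apply]
        congr 3
        exact funext fun x => by rw [Subsingleton.elim x 0]
      have hle : ∀ k, ‖A (slice p i (extendZero i k) f)‖ ^ 2 ≤
          ‖A‖ ^ 2 * ‖slice p i (extendZero i k) f‖ ^ 2 := fun k => by
        rw [← mul_pow]
        gcongr
        exact A.le_opNorm _
      have hb := (hasSum_norm_slice_sq p i f).mul_left (‖A‖ ^ 2)
      have hs1 : Summable fun k => ‖A (slice p i (extendZero i k) f)‖ ^ 2 :=
        Summable.of_nonneg_of_le (fun _ => sq_nonneg _) hle hb.summable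
      have hs : Summable (g ∘ splitEquiv i) := by
        refine (summable_prod_of_nonneg fun _ => sq_nonneg _).2 ⟨fun k => (hrow k).summable, ?_⟩
        exact hs1.congr fun k => (hrow k).tsum_eq.symm
      refine ⟨_, ?_, (splitEquiv i).hasSum_iff.1 hs.hasSum⟩
      rw [mul_pow, (hs.hasSum.prod_fiberwise hrow).tsum_eq.symm]
      exact hasSum_le hle hs1.hasSum hb) (norm_nonneg _)

lemma coeff_ampl (i : Fin n)
    (A : Bergman (fun _ : Fin 1 => p) E →L[ℂ] Bergman (fun _ : Fin 1 => q) F)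
    (f : Bergman m₁ E) (k : Fin n → ℕ) :
    coeff (ampl m₁ m₂ i A f) k = coeff (A (slice p i k f)) fun _ => k i := rfl

@[simp] lemma slice_ampl (i : Fin n)
    (A : Bergman (fun _ : Fin 1 => p) E →L[ℂ] Bergman (fun _ : Fin 1 => q) F)
    (f : Bergman m₁ E) (k : Fin n → ℕ) :
    slice q i k (ampl m₁ m₂ i A f) = A (slice p i k f) :=
  ext_coeff fun j => by
    rw [coeff_slice, coeff_ampl, slice_update, Function.update_self]
    congr 1
    exact funext fun x => by rw [Subsingleton.elim x 0]

lemma hasSum_inner_ampl (i : Fin n)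
    (A : Bergman (fun _ : Fin 1 => p) E →L[ℂ] Bergman (fun _ : Fin 1 => q) F)
    (f : Bergman m₁ E) (g : Bergman m₂ F) :
    HasSum (fun k => ⟪A (slice p i (extendZero i k) f), slice q i (extendZero i k) g⟫_ℂ)
      ⟪ampl m₁ m₂ i A f, g⟫_ℂ := by
  simpa using hasSum_inner_slice q i (ampl m₁ m₂ i A f) g

lemma inner_ampl_ampl (i : Fin n)
    {W : Bergman (fun _ : Fin 1 => p) E →L[ℂ] Bergman (fun _ : Fin 1 => q) F}
    {P : Bergman (fun _ : Fin 1 => p) E →L[ℂ] Bergman (fun _ : Fin 1 => p) E}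
    (hW : ∀ x y, ⟪W x, W y⟫_ℂ = ⟪P x, y⟫_ℂ) (f g : Bergman m₁ E) :
    ⟪ampl m₁ m₂ i W f, ampl m₁ m₂ i W g⟫_ℂ = ⟪ampl m₁ m₁ i P f, g⟫_ℂ := by
  refine (hasSum_inner_ampl i W f _).unique ?_
  simpa [hW] using hasSum_inner_ampl i P f g

lemma isStarProjection_ampl [CompleteSpace E] (i : Fin n)
    {P : Bergman (fun _ : Fin 1 => p) E →L[ℂ] Bergman (fun _ : Fin 1 => p) E}
    (hP : IsStarProjection P) : IsStarProjection (ampl m₁ m₁ i P) where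
  isIdempotentElem := ContinuousLinearMap.ext fun f => eq_of_slice_eq p i fun k => by
    rw [mul_apply_eq_comp, slice_ampl, slice_ampl, ← mul_apply_eq_comp, hP.isIdempotentElem.eq]
  isSelfAdjoint := by
    rw [isSelfAdjoint_iff_isSymmetric]
    intro f g
    simp only [coe_coe]
    rw [← inner_conj_symm f]
    refine (hasSum_inner_ampl i P f g).unique ?_
    have h := (hasSum_inner_ampl i P g f).map (starRingEnd ℂ) Complex.continuous_conj
    convert! h using 2 with k
    rw [Function.comp_apply, inner_conj_symm, ← adjoint_inner_left P, hP.isSelfAdjoint.adjoint_eq]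

/-- The monomial as a function of the `i`-th variable, up to a factor that depends only on the other
variables and on the weights `mⱼ`, `j ≠ i`, so that it is the same for `m₁` and `m₂`. -/
lemma exists_basisMonomial_eq_mul (i : Fin n) (h : ∀ j, j ≠ i → m₁ j = m₂ j) (k : Fin n → ℕ)
    (z : Fin n → ℂ) : ∃ c : ℂ,
      (∀ a, basisMonomial m₁ (Function.update k i a) z =
        c * basisMonomial (fun _ : Fin 1 => m₁ i) (fun _ => a) (fun _ => z i)) ∧
      (∀ a, basisMonomial m₂ (Function.update k i a) z =
        c * basisMonomial (fun _ : Fin 1 => m₂ i) (fun _ => a) (fun _ => z i)) := by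
  have key : ∀ (m : Fin n → ℕ+), (∀ j, j ≠ i → m₁ j = m j) → ∀ a,
      basisMonomial m (Function.update k i a) z =
      ((Real.sqrt (∏ j ∈ Finset.univ.erase i, ((m₁ j : ℕ) + k j - 1).choose (k j) : ℕ) : ℂ) *
        ∏ j ∈ Finset.univ.erase i, z j ^ k j) *
        basisMonomial (fun _ : Fin 1 => m i) (fun _ => a) (fun _ => z i) := by
    intro m hm a
    have h1 : kernelCoeff m (Function.update k i a) =
        (∏ j ∈ Finset.univ.erase i, ((m₁ j : ℕ) + k j - 1).choose (k j)) *
          kernelCoeff (fun _ : Fin 1 => m i) (fun _ => a) := by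
      rw [kernelCoeff, ← Finset.prod_erase_mul _ _ (Finset.mem_univ i)]
      congr 1
      · refine Finset.prod_congr rfl fun j hj => ?_
        rw [Function.update_of_ne (Finset.ne_of_mem_erase hj), hm j (Finset.ne_of_mem_erase hj)]
      · simp [kernelCoeff]
    have h2 : ∏ j, z j ^ Function.update k i a j =
        (∏ j ∈ Finset.univ.erase i, z j ^ k j) * z i ^ a := by
      rw [← Finset.prod_erase_mul _ _ (Finset.mem_univ i), Function.update_self]
      congr 1
      refine Finset.prod_congr rfl fun j hj => ?_
      rw [Function.update_of_ne (Finset.ne_of_mem_erase hj)]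
    rw [basisMonomial, basisMonomial, h1, h2, Nat.cast_mul, Real.sqrt_mul (Nat.cast_nonneg _)]
    simp
    ring
  exact ⟨_, key m₁ fun _ _ => rfl, key m₂ h⟩

/-- If `W` is the adjoint of multiplication by `θ`, then the ampliation of `W` in the `i`-th
variable is the adjoint of multiplication by `θ(zᵢ)`. -/
lemma ampl_kerFun [CompleteSpace E] [CompleteSpace F] (i : Fin n) (h₁ : m₁ i = p) (h₂ : m₂ i = q)
    (h : ∀ j, j ≠ i → m₁ j = m₂ j) {θ : ℂ → F →L[ℂ] E}
    {W : Bergman (fun _ : Fin 1 => p) E →L[ℂ] Bergman (fun _ : Fin 1 => q) F}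
    (hW : ∀ (z : polydisc 1) v, W (RKHS.kerFun (Bergman (fun _ : Fin 1 => p) E) z v) =
      RKHS.kerFun (Bergman (fun _ : Fin 1 => q) F) z (adjoint (θ ((z : Fin 1 → ℂ) 0)) v))
    (z : polydisc n) (v : E) :
    ampl m₁ m₂ i W (RKHS.kerFun (Bergman m₁ E) z v) =
      RKHS.kerFun (Bergman m₂ F) z (adjoint (θ ((z : Fin n → ℂ) i)) v) := by
  subst h₁ h₂
  set w : polydisc 1 := ⟨fun _ => (z : Fin n → ℂ) i, fun _ => z.2 i⟩ with hw
  refine eq_of_slice_eq (m₂ i) i fun k => ?_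
  obtain ⟨c, hc₁, hc₂⟩ := exists_basisMonomial_eq_mul i h k (z : Fin n → ℂ)
  have hj : ∀ j : Fin 1 → ℕ, j = fun _ => j 0 := fun j =>
    funext fun x => by rw [Subsingleton.elim x 0]
  have h3 : slice (m₁ i) i k (RKHS.kerFun (Bergman m₁ E) z v) =
      conj c • RKHS.kerFun (Bergman (fun _ : Fin 1 => m₁ i) E) w v := ext_coeff fun j => by
    rw [coeff_slice, coeff_smul, coeff_kerFun, coeff_kerFun, hc₁, map_mul, smul_smul, ← hj]
  rw [slice_ampl, h3, map_smul, hW]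
  refine ext_coeff fun j => ?_
  rw [coeff_slice, coeff_smul, coeff_kerFun, coeff_kerFun, hc₂, map_mul, smul_smul, ← hj]

end Bergman

end Ampliation

/-! ### Ordered products -/

section OrderedProducts

lemma prod_ofFn_mul {R : Type*} [Monoid R] {n : ℕ} (a b : Fin n → R)
    (h : ∀ i j, i ≠ j → Commute (a i) (b j)) :
    (List.ofFn fun i => a i * b i).prod = (List.ofFn a).prod * (List.ofFn b).prod := by
  induction n with
  | zero => simp
  | succ n ih =>
    have h1 : Commute (List.ofFn fun i : Fin n => a i.succ).prod (b 0) :=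
      Commute.list_prod_left _ _ fun x hx => by
        obtain ⟨i, rfl⟩ := (List.mem_ofFn' _ _).1 hx
        exact h _ _ (Fin.succ_ne_zero i)
    simp only [List.ofFn_succ, List.prod_cons]
    rw [ih (fun i => a i.succ) (fun i => b i.succ) fun i j hij =>
      h _ _ fun h => hij (Fin.succ_injective n h)]
    simp only [mul_assoc]
    rw [← mul_assoc (b 0), ← h1.eq, mul_assoc]

lemma prod_ofFn_smul {R : Type*} [Ring R] [Algebra ℂ R] {n : ℕ} (c : Fin n → ℂ)
    (a : Fin n → R) :
    (List.ofFn fun i => c i • a i).prod = (∏ i, c i) • (List.ofFn a).prod := by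
  induction n with
  | zero => simp
  | succ n ih =>
    simp only [List.ofFn_succ, List.prod_cons, Fin.prod_univ_succ]
    rw [ih, smul_mul_smul_comm]

/-- Distributivity for ordered products in a noncommutative ring. -/
lemma sum_piFinset_prod_ofFn {R : Type*} [Semiring R] {n : ℕ} (t : Fin n → Finset ℕ)
    (a : Fin n → ℕ → R) :
    ∑ k ∈ Fintype.piFinset t, (List.ofFn fun i => a i (k i)).prod =
      (List.ofFn fun i => ∑ j ∈ t i, a i j).prod := by
  induction n with
  | zero => simp
  | succ n ih =>
    simp only [List.ofFn_succ, List.prod_cons]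
    rw [← ih, Finset.sum_mul_sum, ← Finset.sum_product']
    refine Finset.sum_equiv (Fin.consEquiv fun _ => ℕ).symm (fun k => ?_) fun k _ => rfl
    simp [Fin.consEquiv, Fin.forall_fin_succ, Fin.tail]

lemma prod_ofFn_eq_mul_update {R : Type*} [Monoid R] {n : ℕ} (a : Fin n → R) (i : Fin n)
    (h : ∀ j, j ≠ i → Commute (a i) (a j)) :
    (List.ofFn a).prod = a i * (List.ofFn (Function.update a i 1)).prod := by
  induction n with
  | zero => exact i.elim0
  | succ n ih =>
    refine Fin.cases (fun _ => ?_) (fun i h => ?_) i h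
    · simp [List.ofFn_succ]
    · simp only [List.ofFn_succ, List.prod_cons]
      have h1 : (fun j : Fin n => Function.update a i.succ 1 j.succ) =
          Function.update (fun j => a j.succ) i 1 := by
        funext j
        by_cases hj : j = i
        · subst hj; simp
        · rw [Function.update_of_ne hj,
            Function.update_of_ne fun h => hj (Fin.succ_injective n h)]
      rw [h1, ih (fun j => a j.succ) i fun j hj => h _ fun h => hj (Fin.succ_injective n h),
        Function.update_of_ne (Fin.succ_ne_zero i).symm, ← mul_assoc, ← mul_assoc,
        (h 0 (Fin.succ_ne_zero i).symm).eq]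

end OrderedProducts

/-! ### Doubly commuting tuples -/

section Tuples

variable {H : Type*} [NormedAddCommGroup H] [InnerProductSpace ℂ H] [CompleteSpace H]
variable {n : ℕ} {m : Fin n → ℕ+} {T : Fin n → H →L[ℂ] H}

lemma IsDoublyCommuting.commute_adjoint_of_ne (hT : IsDoublyCommuting T) {i j : Fin n}
    (h : i ≠ j) : Commute (T i) (adjoint (T j)) := by
  rcases lt_or_gt_of_ne h with h | h
  · exact hT.commute_adjoint i j h
  · have := (hT.commute_adjoint j i h).star_star
    simp only [star_eq_adjoint, adjoint_adjoint] at this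
    exact this.symm

lemma IsDoublyCommuting.adjoint_commute_adjoint (hT : IsDoublyCommuting T) (i j : Fin n) :
    Commute (adjoint (T i)) (adjoint (T j)) :=
  (hT.commute i j).star_star

lemma commute_invKernel {p : ℕ+} {A X : H →L[ℂ] H} (h : Commute X A)
    (h' : Commute X (adjoint A)) : Commute X (invKernel p A) :=
  Commute.sum_right _ _ _ fun k _ => ((h.pow_right k).mul_right (h'.pow_right k)).smul_right _

lemma IsDoublyCommuting.commute_invKernel (hT : IsDoublyCommuting T) (p : ℕ+) {i j : Fin n}
    (h : i ≠ j) : Commute (T i) (invKernel p (T j)) :=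
  BergmanModel.commute_invKernel (hT.commute i j) (hT.commute_adjoint_of_ne h)

lemma IsDoublyCommuting.adjoint_commute_invKernel (hT : IsDoublyCommuting T) (p : ℕ+)
    {i j : Fin n} (h : i ≠ j) : Commute (adjoint (T i)) (invKernel p (T j)) :=
  BergmanModel.commute_invKernel (hT.commute_adjoint_of_ne h.symm).symm
    (hT.adjoint_commute_adjoint i j)

lemma IsDoublyCommuting.invKernel_commute_invKernel (hT : IsDoublyCommuting T) (p q : ℕ+)
    {i j : Fin n} (h : i ≠ j) : Commute (invKernel p (T i)) (invKernel q (T j)) :=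
  BergmanModel.commute_invKernel (hT.commute_invKernel p h.symm).symm
    (hT.adjoint_commute_invKernel p h.symm).symm

/-- For doubly commuting tuples the joint defect is the product of the defects. -/
theorem IsDoublyCommuting.jointInvKernel_eq (hT : IsDoublyCommuting T) (m : Fin n → ℕ+) :
    jointInvKernel m T = (List.ofFn fun i => invKernel (m i) (T i)).prod := by
  unfold jointInvKernel invKernel
  rw [← sum_piFinset_prod_ofFn (fun i => Finset.range ((m i : ℕ) + 1)) fun i k =>
    ((-1) ^ k * ((m i : ℕ).choose k : ℂ)) • (T i ^ k * adjoint (T i) ^ k)]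
  refine Finset.sum_congr rfl fun k _ => ?_
  rw [prod_ofFn_smul, prod_ofFn_mul]
  · rfl
  · exact fun i j h => (hT.commute_adjoint_of_ne h).pow_pow _ _

/-- The product of the defects of the operators other than `Tᵢ`. -/
def defectErase (m : Fin n → ℕ+) (T : Fin n → H →L[ℂ] H) (i : Fin n) : H →L[ℂ] H :=
  (List.ofFn (Function.update (fun j => invKernel (m j) (T j)) i 1)).prod

lemma commute_defectErase {X : H →L[ℂ] H} {i : Fin n}
    (h : ∀ j, j ≠ i → Commute X (invKernel (m j) (T j))) : Commute X (defectErase m T i) := by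
  refine Commute.list_prod_right _ _ fun x hx => ?_
  obtain ⟨j, rfl⟩ := (List.mem_ofFn' _ _).1 hx
  by_cases hj : j = i
  · subst hj; simp
  · rw [Function.update_of_ne hj]; exact h j hj

lemma IsDoublyCommuting.jointInvKernel_eq_mul (hT : IsDoublyCommuting T) (m : Fin n → ℕ+)
    (i : Fin n) : jointInvKernel m T = invKernel (m i) (T i) * defectErase m T i := by
  rw [hT.jointInvKernel_eq, prod_ofFn_eq_mul_update _ i fun j hj =>
    hT.invKernel_commute_invKernel _ _ hj.symm]
  rfl

lemma IsDoublyCommuting.defectMap_defectErase (hT : IsDoublyCommuting T) (m : Fin n → ℕ+)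
    (i : Fin n) : (defectMap (T i))^[m i] (defectErase m T i) = jointInvKernel m T := by
  rw [defectMap_iterate_eq_invKernel_mul, hT.jointInvKernel_eq_mul m i]
  exact commute_defectErase fun j hj => hT.adjoint_commute_invKernel _ hj.symm

lemma IsDoublyCommuting.defectErase_mul (hT : IsDoublyCommuting T) (m : Fin n → ℕ+)
    (i : Fin n) (l : ℕ) : defectErase m T i * (T i ^ l * invKernel (m i) (T i)) =
      T i ^ l * jointInvKernel m T := by
  have h1 : Commute (T i ^ l) (defectErase m T i) :=
    (commute_defectErase fun j hj => hT.commute_invKernel _ hj.symm).pow_left l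
  have h2 : Commute (invKernel (m i) (T i)) (defectErase m T i) :=
    commute_defectErase fun j hj => hT.invKernel_commute_invKernel _ _ hj.symm
  rw [← mul_assoc, ← h1.eq, mul_assoc, ← h2.eq, hT.jointInvKernel_eq_mul m i]

lemma IsDoublyCommuting.tuplePow_mul_eq (hT : IsDoublyCommuting T) (m : Fin n → ℕ+)
    (k l : Fin n → ℕ) :
    tuplePow (fun i => adjoint (T i)) k * (tuplePow T l * jointInvKernel m T) =
      (List.ofFn fun i =>
        adjoint (T i) ^ k i * (T i ^ l i * invKernel (m i) (T i))).prod := by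
  have h1 : ∀ i j, i ≠ j → Commute (T i ^ l i) (invKernel (m j) (T j)) :=
    fun i j h => (hT.commute_invKernel _ h).pow_left _
  rw [prod_ofFn_mul, prod_ofFn_mul _ _ h1, hT.jointInvKernel_eq]
  · rfl
  · exact fun i j h => ((hT.commute_adjoint_of_ne h.symm).symm.pow_pow _ _).mul_right
      ((hT.adjoint_commute_invKernel _ h).pow_left _)

/-- The expansion of the identity in terms of the joint defect, by induction on the number of
operators: the product of the defects of the operators other than the first one has the joint
defect as its defect with respect to the first operator. -/
theorem IsDoublyCommuting.hasSum_kernelCoeff_mul_inner (hT : IsDoublyCommuting T)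
    (hp : ∀ i, IsPure (T i)) (hpos : (jointInvKernel m T).IsPositive) (h : H) :
    HasSum (fun k => (kernelCoeff m k : ℝ) *
      (⟪jointInvKernel m T (tuplePow (fun i => adjoint (T i)) k h),
        tuplePow (fun i => adjoint (T i)) k h⟫_ℂ).re) (‖h‖ ^ 2) := by
  induction n with
  | zero =>
    have h1 := hasSum_unique (fun k : Fin 0 → ℕ => (kernelCoeff m k : ℝ) *
      (⟪jointInvKernel m T (tuplePow (fun i => adjoint (T i)) k h),
        tuplePow (fun i => adjoint (T i)) k h⟫_ℂ).re)
    convert! h1 using 1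
    rw [hT.jointInvKernel_eq]
    simp [tuplePow, kernelCoeff, inner_self_eq_norm_sq_to_K, ← Complex.ofReal_pow]
  | succ n ih =>
    have hT' : IsDoublyCommuting fun i : Fin n => T i.succ :=
      ⟨fun i j => hT.commute _ _, fun p q hpq =>
        hT.commute_adjoint _ _ (Fin.succ_lt_succ_iff.2 hpq)⟩
    have hJ : jointInvKernel m T =
        (defectMap (T 0))^[m 0] (jointInvKernel (fun i => m i.succ) fun i => T i.succ) := by
      rw [defectMap_iterate_eq_invKernel_mul, hT.jointInvKernel_eq, hT'.jointInvKernel_eq,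
        List.ofFn_succ, List.prod_cons]
      rw [hT'.jointInvKernel_eq]
      refine Commute.list_prod_right _ _ fun x hx => ?_
      obtain ⟨j, rfl⟩ := (List.mem_ofFn' _ _).1 hx
      exact hT.adjoint_commute_invKernel _ (Fin.succ_ne_zero j).symm
    have hpos' := hpos
    rw [hJ] at hpos'
    have h1 := ih (m := fun i => m i.succ) hT' (fun i => hp _)
      (isPositive_of_defectMap (m 0) (hp 0) hpos')
    rw [← ((Equiv.prodComm _ _).trans (Fin.consEquiv fun _ => ℕ)).hasSum_iff]
    set f : ((Fin n → ℕ) × ℕ) → ℝ := _ ∘ ⇑((Equiv.prodComm (Fin n → ℕ) ℕ).trans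
      (Fin.consEquiv fun _ => ℕ)) with hf
    have hf0 : 0 ≤ f := fun q => mul_nonneg (by positivity) (hpos.re_inner_nonneg_left _)
    have hrow : ∀ k, HasSum (fun a => f (k, a)) ((kernelCoeff (fun i => m i.succ) k : ℝ) *
        (⟪jointInvKernel (fun i => m i.succ) (fun i => T i.succ)
          (tuplePow (fun i : Fin n => adjoint (T i.succ)) k h),
          tuplePow (fun i : Fin n => adjoint (T i.succ)) k h⟫_ℂ).re) := fun k => by
      have h2 := (hasSum_choose_mul_inner_defectMap (m 0) (hp 0) hpos'
        (tuplePow (fun i : Fin n => adjoint (T i.succ)) k h)).mapL Complex.reCLM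
      have h3 := h2.mul_left (kernelCoeff (fun i => m i.succ) k : ℝ)
      rw [← hJ] at h3
      convert! h3 using 2 with a
      simp only [hf, Function.comp_apply, Equiv.trans_apply, Equiv.prodComm_apply,
        Prod.swap_prod_mk,
        Fin.consEquiv_apply, kernelCoeff, Fin.prod_univ_succ, Fin.cons_zero, Fin.cons_succ,
        tuplePow, List.ofFn_succ, List.prod_cons, mul_apply_eq_comp, Complex.reCLM_apply]
      rw [← Complex.ofReal_natCast, Complex.re_ofReal_mul]
      push_cast
      ring
    have hs : Summable f := by
      refine (summable_prod_of_nonneg hf0).2 ⟨fun k => (hrow k).summable, ?_⟩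
      exact h1.summable.congr fun k => (hrow k).tsum_eq.symm
    have h2 := hs.hasSum
    rwa [(h2.prod_fiberwise hrow).unique h1] at h2

end Tuples

section

variable {H : Type*} [NormedAddCommGroup H] [InnerProductSpace ℂ H]
variable {n : ℕ} {m : Fin n → ℕ+} {T : Fin n → H →L[ℂ] H}
variable {F : Type*} [NormedAddCommGroup F] [InnerProductSpace ℂ F]

/-! ### The dilation of a doubly commuting tuple -/

lemma tuplePow_update (hT : ∀ i j, Commute (T i) (T j)) (k : Fin n → ℕ) (i : Fin n) (a : ℕ) :
    tuplePow T (Function.update k i a) = T i ^ a * tuplePow T (Function.update k i 0) := by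
  rw [tuplePow, prod_ofFn_eq_mul_update _ i fun j _ => (hT i j).pow_pow _ _, Function.update_self,
    tuplePow]
  congr 3
  funext j
  by_cases hj : j = i
  · subst hj; simp
  · simp [hj]

lemma tuplePow_add_single (hT : ∀ i j, Commute (T i) (T j)) (k : Fin n → ℕ) (i : Fin n) :
    tuplePow T (k + Pi.single i 1) = tuplePow T k * T i := by
  have h1 : k + Pi.single i 1 = Function.update k i (k i + 1) := by
    funext j
    by_cases hj : j = i
    · subst hj; simp
    · simp [hj]
  have h2 := tuplePow_update hT k i (k i)
  rw [Function.update_eq_self] at h2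
  have h3 : Commute (T i) (tuplePow T (Function.update k i 0)) :=
    Commute.list_prod_right _ _ fun x hx => by
      obtain ⟨j, rfl⟩ := (List.mem_ofFn' _ _).1 hx
      exact (hT i j).pow_right _
  rw [h1, tuplePow_update hT, h2, pow_succ, mul_assoc, mul_assoc, h3.eq]

lemma star_prod_ofFn {R : Type*} [Monoid R] [StarMul R] {n : ℕ} (a : Fin n → R)
    (h : ∀ i j, Commute (a i) (a j)) :
    star (List.ofFn a).prod = (List.ofFn fun i => star (a i)).prod := by
  induction n with
  | zero => simp
  | succ n ih =>
    simp only [List.ofFn_succ, List.prod_cons, star_mul]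
    rw [ih (fun i => a i.succ) fun i j => h _ _]
    refine (Commute.list_prod_right _ _ fun x hx => ?_).eq.symm
    obtain ⟨j, rfl⟩ := (List.mem_ofFn' _ _).1 hx
    exact (h _ _).star_star

variable [CompleteSpace H]

lemma adjoint_tuplePow (hT : ∀ i j, Commute (T i) (T j)) (k : Fin n → ℕ) :
    adjoint (tuplePow T k) = tuplePow (fun i => adjoint (T i)) k := by
  rw [tuplePow, ← star_eq_adjoint, star_prod_ofFn _ fun i j => (hT i j).pow_pow _ _]
  simp only [star_pow, star_eq_adjoint]
  rfl

/-- The `i`-th factor of the kernel coefficient splits off: at the exponent `0` it is `1`. -/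
lemma kernelCoeff_update (m : Fin n → ℕ+) (k : Fin n → ℕ) (i : Fin n) (a : ℕ) :
    kernelCoeff m (Function.update k i a) = kernelCoeff m (Function.update k i 0) *
      kernelCoeff (fun _ : Fin 1 => m i) (fun _ => a) := by
  rw [kernelCoeff, kernelCoeff, ← Finset.prod_erase_mul _ _ (Finset.mem_univ i),
    ← Finset.prod_erase_mul _ _ (Finset.mem_univ i)]
  simp only [Function.update_self, Nat.choose_zero_right, mul_one, kernelCoeff,
    Finset.univ_unique, Finset.prod_singleton]
  congr 1
  refine Finset.prod_congr rfl fun j hj => ?_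
  rw [Function.update_of_ne (Finset.ne_of_mem_erase hj),
    Function.update_of_ne (Finset.ne_of_mem_erase hj)]

variable {D : H →L[ℂ] F}

/-- The coefficients of a dilation transform the adjoints of the operators into backward
shifts. -/
lemma backwardShift_of_coeff (hT : ∀ i j, Commute (T i) (T j)) {V : H →L[ℂ] Bergman m F}
    (hV : ∀ h k, Bergman.coeff (V h) k = (Real.sqrt (kernelCoeff m k) : ℂ) •
      D (tuplePow (fun i => adjoint (T i)) k h)) (i : Fin n) (h : H) :
    Bergman.backwardShift m F i (V h) = V (adjoint (T i) h) := by
  refine Bergman.ext_coeff fun k => ?_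
  rw [Bergman.coeff_backwardShift, hV, hV,
    tuplePow_add_single (T := fun i => adjoint (T i)) fun i j => (hT i j).star_star,
    mul_apply_eq_comp, smul_smul, Complex.ofReal_div,
    div_mul_cancel₀ _ (Bergman.sqrt_kernelCoeff_ne_zero m _)]

/-- The projections `1 - Pᵢ`, acting in the `i`-th variable, multiply like the operators
`Tᵢ*ᵏ Tᵢˡ Δᵢ`. -/
lemma coeff_prod_one_sub_ampl {T : Fin n → H →L[ℂ] H}
    {P : ∀ i, Bergman (fun _ : Fin 1 => m i) F →L[ℂ] Bergman (fun _ : Fin 1 => m i) F}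
    {W : ∀ i, H →L[ℂ] Bergman (fun _ : Fin 1 => m i) F}
    (hW : ∀ i h k, Bergman.coeff (W i h) k =
      (Real.sqrt (kernelCoeff (fun _ : Fin 1 => m i) k) : ℂ) • D ((adjoint (T i) ^ k 0) h))
    (hPW : ∀ i (l : Fin 1 → ℕ) y, Bergman.single (fun _ : Fin 1 => m i) l (D y) -
        P i (Bergman.single (fun _ : Fin 1 => m i) l (D y)) =
      W i ((Real.sqrt (kernelCoeff (fun _ : Fin 1 => m i) l) : ℂ) •
        (T i ^ l 0 * invKernel (m i) (T i)) y))
    {s : List (Fin n)} (hs : s.Nodup) (l k : Fin n → ℕ) (y : H) :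
    Bergman.coeff ((s.map fun i => 1 - Bergman.ampl m m i (P i)).prod
      (Bergman.single m l (D y))) k =
    if ∀ j, j ∉ s → k j = l j then
      (s.map fun i => (Real.sqrt (kernelCoeff (fun _ : Fin 1 => m i) fun _ => k i) : ℂ) *
        Real.sqrt (kernelCoeff (fun _ : Fin 1 => m i) fun _ => l i)).prod •
      D ((s.map fun i => adjoint (T i) ^ k i * (T i ^ l i * invKernel (m i) (T i))).prod y)
    else 0 := by
  induction s generalizing k with
  | nil =>
    simp [Bergman.coeff_single, funext_iff]
  | cons a s ih =>
    obtain ⟨has, hs⟩ := List.nodup_cons.1 hs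
    set g := (s.map fun i => 1 - Bergman.ampl m m i (P i)).prod (Bergman.single m l (D y)) with hg
    set c := (s.map fun i => (Real.sqrt (kernelCoeff (fun _ : Fin 1 => m i) fun _ => k i) : ℂ) *
        Real.sqrt (kernelCoeff (fun _ : Fin 1 => m i) fun _ => l i)).prod with hc
    set Y := (s.map fun i => adjoint (T i) ^ k i * (T i ^ l i * invKernel (m i) (T i))).prod with hY
    -- Only the exponent `l a` occurs in the slices of `g`, as `a` is not in `s`.
    have hslice : Bergman.slice (m a) a k g = if ∀ j, j ∉ a :: s → k j = l j then
        Bergman.single (fun _ : Fin 1 => m a) (fun _ => l a) (D (c • Y y)) else 0 := by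
      have hne : ∀ i ∈ s, ∀ b, Function.update k a b i = k i := fun i hi b =>
        Function.update_of_ne (by rintro rfl; exact has hi) _ _
      refine Bergman.ext_coeff fun j => ?_
      rw [Bergman.coeff_slice, ih hs]
      have h1 : (s.map fun i => (Real.sqrt (kernelCoeff (fun _ : Fin 1 => m i)
          fun _ => Function.update k a (j 0) i) : ℂ) *
          Real.sqrt (kernelCoeff (fun _ : Fin 1 => m i) fun _ => l i)).prod = c := by
        rw [hc]
        congr 1
        exact List.map_congr_left fun i hi => by rw [hne i hi]
      have h2 : (s.map fun i => adjoint (T i) ^ Function.update k a (j 0) i *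
          (T i ^ l i * invKernel (m i) (T i))).prod = Y := by
        rw [hY]
        congr 1
        exact List.map_congr_left fun i hi => by rw [hne i hi]
      have h3 : (∀ i, i ∉ s → Function.update k a (j 0) i = l i) ↔
          (∀ i, i ∉ a :: s → k i = l i) ∧ j = fun _ => l a := by
        constructor
        · intro h
          refine ⟨fun i hi => ?_, funext fun x => ?_⟩
          · rw [List.mem_cons, not_or] at hi
            rw [← h i hi.2, Function.update_of_ne hi.1]
          · rw [Subsingleton.elim x 0, ← h a has, Function.update_self]
        · rintro ⟨h, rfl⟩ i hi
          by_cases hia : i = a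
          · subst hia; simp
          · rw [Function.update_of_ne hia, h i (by simp [hia, hi])]
      rw [h1, h2]
      by_cases h4 : ∀ i, i ∉ a :: s → k i = l i
      · by_cases h5 : j = fun _ => l a
        · rw [if_pos (h3.2 ⟨h4, h5⟩), if_pos h4, Bergman.coeff_single, if_pos h5, map_smul]
        · rw [if_neg fun h => h5 (h3.1 h).2, if_pos h4, Bergman.coeff_single, if_neg h5]
      · rw [if_neg fun h => h4 (h3.1 h).1, if_neg h4]
        rfl
    have h1 : Bergman.coeff (((a :: s).map fun i => 1 - Bergman.ampl m m i (P i)).prod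
        (Bergman.single m l (D y))) k = Bergman.coeff (Bergman.slice (m a) a k g -
          P a (Bergman.slice (m a) a k g)) fun _ => k a := by
      rw [List.map_cons, List.prod_cons, mul_apply_eq_comp, ← hg, sub_apply, one_apply_eq_self,
        Bergman.coeff_sub, Bergman.coeff_sub, Bergman.coeff_ampl, Bergman.coeff_slice,
        Function.update_eq_self]
    rw [h1, hslice]
    by_cases h4 : ∀ i, i ∉ a :: s → k i = l i
    · rw [if_pos h4, if_pos h4, hPW, hW, List.map_cons, List.prod_cons, List.map_cons,
        List.prod_cons, ← hc, ← hY]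
      simp only [map_smul, smul_smul, mul_apply_eq_comp]
      congr 1
      ring
    · rw [if_neg h4, if_neg h4, map_zero, sub_zero]
      rfl

variable [CompleteSpace F]

lemma IsDoublyCommuting.exists_dilation (hT : IsDoublyCommuting T) (hp : ∀ i, IsPure (T i))
    (hpos : (jointInvKernel m T).IsPositive)
    (hD : ∀ x y, ⟪D x, D y⟫_ℂ = ⟪jointInvKernel m T x, y⟫_ℂ) :
    ∃ V : H →L[ℂ] Bergman m F,
      (∀ h k, Bergman.coeff (V h) k = (Real.sqrt (kernelCoeff m k) : ℂ) •
        D (tuplePow (fun i => adjoint (T i)) k h)) ∧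
      ∀ x y, ⟪V x, V y⟫_ℂ = ⟪x, y⟫_ℂ := by
  refine Bergman.exists_coeff_eq m (fun k => (Real.sqrt (kernelCoeff m k) : ℂ) •
    (D ∘L tuplePow (fun i => adjoint (T i)) k)) 1 fun h => ?_
  rw [one_apply_eq_self, inner_self_eq_norm_sq_to_K]
  have h1 := hT.hasSum_kernelCoeff_mul_inner hp hpos h
  simp only [← hD, inner_self_eq_norm_sq_to_K] at h1
  have h2 : HasSum (fun k => ‖((Real.sqrt (kernelCoeff m k) : ℂ) •
      (D ∘L tuplePow (fun i => adjoint (T i)) k)) h‖ ^ 2) (‖h‖ ^ 2) := by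
    convert! h1 using 2 with k
    simp [norm_smul, mul_pow, ← Complex.ofReal_pow]
  have h3 := Complex.hasSum_ofReal.2 h2
  rw [Complex.ofReal_pow] at h3
  exact h3

/-- The part of the dilation that belongs to a single operator of the tuple. -/
lemma IsDoublyCommuting.exists_dilation_component (hT : IsDoublyCommuting T)
    (hp : ∀ i, IsPure (T i)) (hpos : (jointInvKernel m T).IsPositive)
    (hD : ∀ x y, ⟪D x, D y⟫_ℂ = ⟪jointInvKernel m T x, y⟫_ℂ) (i : Fin n) :
    ∃ W : H →L[ℂ] Bergman (fun _ : Fin 1 => m i) F,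
      (∀ h k, Bergman.coeff (W h) k =
        (Real.sqrt (kernelCoeff (fun _ : Fin 1 => m i) k) : ℂ) •
          D ((adjoint (T i) ^ k 0) h)) ∧
      ∀ x y, ⟪W x, W y⟫_ℂ = ⟪defectErase m T i x, y⟫_ℂ := by
  have h := hT.defectMap_defectErase m i
  exact exists_oneVar_gram (m i) (hp i) (by rwa [h]) D (by rwa [h])

/-- The orthogonal complement of the range of the `i`-th component of the dilation is invariant
under multiplication by `z`. -/
lemma shift_mem_orthogonal_range {i : Fin n} {W : H →L[ℂ] Bergman (fun _ : Fin 1 => m i) F}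
    (hW : ∀ h k, Bergman.coeff (W h) k =
      (Real.sqrt (kernelCoeff (fun _ : Fin 1 => m i) k) : ℂ) • D ((adjoint (T i) ^ k 0) h))
    {f : Bergman (fun _ : Fin 1 => m i) F} (hf : f ∈ (LinearMap.range (W : H →ₗ[ℂ] _))ᗮ) :
    shift (fun _ : Fin 1 => m i) F 0 f ∈ (LinearMap.range (W : H →ₗ[ℂ] _))ᗮ := by
  rw [Submodule.mem_orthogonal] at hf ⊢
  rintro _ ⟨h, rfl⟩
  -- `W` has the coefficients of the dilation of the tuple with the single entry `T i`.
  have h1 := backwardShift_of_coeff (m := fun _ : Fin 1 => m i) (T := fun _ : Fin 1 => T i)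
    (D := D) (V := W) (fun _ _ => Commute.refl _) (fun h k => by simp [hW, tuplePow]) 0 h
  rw [← adjoint_inner_left, Bergman.adjoint_shift]
  exact (congrArg (fun g => ⟪g, f⟫_ℂ) h1).trans (hf _ ⟨_, rfl⟩)

/-- The projection onto the closure of the range of the `i`-th component `W` of the dilation, on
monomials. It follows from `W* W = ∏_{j ≠ i} Δⱼ`, where `Δⱼ` is the defect of `Tⱼ`, and
`D* D = ∏ⱼ Δⱼ`. -/
lemma IsDoublyCommuting.single_sub_starProjection (hT : IsDoublyCommuting T)
    (hD : ∀ x y, ⟪D x, D y⟫_ℂ = ⟪jointInvKernel m T x, y⟫_ℂ) {i : Fin n}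
    {W : H →L[ℂ] Bergman (fun _ : Fin 1 => m i) F}
    (hW : ∀ h k, Bergman.coeff (W h) k =
      (Real.sqrt (kernelCoeff (fun _ : Fin 1 => m i) k) : ℂ) • D ((adjoint (T i) ^ k 0) h))
    (hWW : ∀ x y, ⟪W x, W y⟫_ℂ = ⟪defectErase m T i x, y⟫_ℂ) (l : Fin 1 → ℕ) (y : H) :
    Bergman.single (fun _ : Fin 1 => m i) l (D y) -
      (LinearMap.range (W : H →ₗ[ℂ] _))ᗮ.starProjection
        (Bergman.single (fun _ : Fin 1 => m i) l (D y)) =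
    W ((Real.sqrt (kernelCoeff (fun _ : Fin 1 => m i) l) : ℂ) •
      (T i ^ l 0 * invKernel (m i) (T i)) y) := by
  set u := (Real.sqrt (kernelCoeff (fun _ : Fin 1 => m i) l) : ℂ) •
      (T i ^ l 0 * invKernel (m i) (T i)) y with hu
  have hsu : ∀ h, ⟪Bergman.single (fun _ : Fin 1 => m i) l (D y) - W u, W h⟫_ℂ = 0 := fun h => by
    have h1 : defectErase m T i u = (Real.sqrt (kernelCoeff (fun _ : Fin 1 => m i) l) : ℂ) •
        (T i ^ l 0) (jointInvKernel m T y) := by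
      rw [hu, map_smul, ← mul_apply_eq_comp, hT.defectErase_mul, mul_apply_eq_comp]
    have h2 : ∀ x, ⟪(T i ^ l 0) x, h⟫_ℂ = ⟪x, (adjoint (T i) ^ l 0) h⟫_ℂ := fun x => by
      rw [← adjoint_inner_right, ← star_eq_adjoint, star_pow, star_eq_adjoint]
    rw [inner_sub_left, hWW, h1, ← inner_conj_symm, Bergman.inner_single, inner_conj_symm, hW,
      inner_smul_right, inner_smul_left, hD, h2, Complex.conj_ofReal, sub_self]
  rw [Submodule.eq_starProjection_of_mem_orthogonal
    (v := Bergman.single (fun _ : Fin 1 => m i) l (D y) - W u), sub_sub_cancel]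
  · rw [Submodule.mem_orthogonal']
    rintro _ ⟨h, rfl⟩
    exact hsu h
  · rw [sub_sub_cancel]
    exact Submodule.le_orthogonal_orthogonal _ ⟨u, rfl⟩

end

section
variable {H : Type*} [NormedAddCommGroup H] [InnerProductSpace ℂ H] [CompleteSpace H]
variable {n : ℕ} {m : Fin n → ℕ+} {T : Fin n → H →L[ℂ] H}
variable {F : Type*} [NormedAddCommGroup F] [InnerProductSpace ℂ F] [CompleteSpace F]
variable {D : H →L[ℂ] F}

/-! ### The complement of the dilation space -/

lemma sub_prod_one_sub_mem_iSup_range {ι K : Type*} [NormedAddCommGroup K] [InnerProductSpace ℂ K]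
    (p : ι → K →L[ℂ] K) (s : List ι) (f : K) :
    f - (s.map fun i => 1 - p i).prod f ∈ ⨆ i, LinearMap.range (p i : K →ₗ[ℂ] K) := by
  induction s with
  | nil => simp
  | cons a s ih =>
    have h1 : f - ((a :: s).map fun i => 1 - p i).prod f =
        (f - (s.map fun i => 1 - p i).prod f) + p a ((s.map fun i => 1 - p i).prod f) := by
      rw [List.map_cons, List.prod_cons, mul_apply_eq_comp, sub_apply, one_apply_eq_self]
      abel
    rw [h1]
    exact add_mem ih (Submodule.mem_iSup_of_mem a ⟨_, rfl⟩)

lemma prod_sqrt_kernelCoeff (m : Fin n → ℕ+) (k : Fin n → ℕ) :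
    ∏ i, (Real.sqrt (kernelCoeff (fun _ : Fin 1 => m i) fun _ => k i) : ℂ) =
      Real.sqrt (kernelCoeff m k) := by
  rw [← Complex.ofReal_prod, ← Real.sqrt_prod _ fun _ _ => Nat.cast_nonneg _]
  simp [kernelCoeff]

/-- The sum of the ranges of the ampliated projections `Pᵢ` is the complement of the range of the
dilation `V`: each of them annihilates the range of `V`, and the product of their complements
is `V V*`. -/
theorem IsDoublyCommuting.iSup_range_ampl (hT : IsDoublyCommuting T) (hDr : DenseRange D)
    (hD : ∀ x y, ⟪D x, D y⟫_ℂ = ⟪jointInvKernel m T x, y⟫_ℂ)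
    {V : H →L[ℂ] Bergman m F}
    (hV : ∀ h k, Bergman.coeff (V h) k = (Real.sqrt (kernelCoeff m k) : ℂ) •
        D (tuplePow (fun i => adjoint (T i)) k h))
    {W : ∀ i, H →L[ℂ] Bergman (fun _ : Fin 1 => m i) F}
    (hW : ∀ i h k, Bergman.coeff (W i h) k =
      (Real.sqrt (kernelCoeff (fun _ : Fin 1 => m i) k) : ℂ) • D ((adjoint (T i) ^ k 0) h))
    (hWW : ∀ i x y, ⟪W i x, W i y⟫_ℂ = ⟪defectErase m T i x, y⟫_ℂ) :
    ⨆ i, LinearMap.range (Bergman.ampl m m i (LinearMap.range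
      (W i : H →ₗ[ℂ] Bergman (fun _ : Fin 1 => m i) F))ᗮ.starProjection :
        Bergman m F →ₗ[ℂ] Bergman m F) =
    (LinearMap.range (V : H →ₗ[ℂ] Bergman m F))ᗮ := by
  set P : ∀ i, Bergman (fun _ : Fin 1 => m i) F →L[ℂ] Bergman (fun _ : Fin 1 => m i) F :=
    fun i => (LinearMap.range
      (W i : H →ₗ[ℂ] Bergman (fun _ : Fin 1 => m i) F))ᗮ.starProjection with hP
  have hTs : ∀ i j, Commute (adjoint (T i)) (adjoint (T j)) := hT.adjoint_commute_adjoint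
  refine le_antisymm (iSup_le fun i => ?_) fun f hf => ?_
  · rintro _ ⟨f, rfl⟩
    rw [Submodule.mem_orthogonal]
    rintro _ ⟨h, rfl⟩
    -- The slices of `V h` are in the range of `W i`, on which the projection vanishes.
    have hPV : Bergman.ampl m m i (P i) (V h) = 0 := by
      refine Bergman.eq_of_slice_eq (m i) i fun k => ?_
      have h1 : Bergman.slice (m i) i k (V h) =
          W i ((Real.sqrt (kernelCoeff m (Function.update k i 0)) : ℂ) •
            tuplePow (fun i => adjoint (T i)) (Function.update k i 0) h) :=
        Bergman.ext_coeff fun j => by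
          have hj : j = fun _ => j 0 := funext fun x => by rw [Subsingleton.elim x 0]
          rw [Bergman.coeff_slice, hV, hW, kernelCoeff_update, ← hj, tuplePow_update hTs,
            Nat.cast_mul, Real.sqrt_mul (Nat.cast_nonneg _), map_smul, map_smul, smul_smul,
            mul_apply_eq_comp]
          push_cast
          rw [mul_comm]
      rw [Bergman.slice_ampl, h1, map_zero]
      exact (Submodule.starProjection_apply_eq_zero_iff _).2
        (Submodule.le_orthogonal_orthogonal _ ⟨_, rfl⟩)
    have hs : adjoint (Bergman.ampl m m i (P i)) = Bergman.ampl m m i (P i) :=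
      (Bergman.isStarProjection_ampl i isStarProjection_starProjection).isSelfAdjoint.adjoint_eq
    simp only [coe_coe]
    rw [← adjoint_inner_left (Bergman.ampl m m i (P i)), hs, hPV, inner_zero_left]
  -- For `f` in the complement, `f = f - V V* f`, and `V V*` is the product of the `1 - Pᵢ`.
  · have hR : ((List.finRange n).map fun i => 1 - Bergman.ampl m m i (P i)).prod =
        V ∘L adjoint V := by
      refine Bergman.clm_ext_single hDr fun l y => Bergman.ext_coeff fun k => ?_
      have h1 : adjoint V (Bergman.single m l (D y)) =
          (Real.sqrt (kernelCoeff m l) : ℂ) • tuplePow T l (jointInvKernel m T y) := by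
        refine ext_inner_right ℂ fun h => ?_
        rw [adjoint_inner_left, ← inner_conj_symm, Bergman.inner_single, inner_conj_symm, hV,
          inner_smul_right, inner_smul_left, hD, Complex.conj_ofReal,
          ← adjoint_tuplePow hT.commute, adjoint_inner_right]
      rw [coeff_prod_one_sub_ampl hW
        (fun i l y => hT.single_sub_starProjection hD (hW i) (hWW i) l y)
        (List.nodup_finRange n), if_pos fun j hj => absurd (List.mem_finRange j) hj, comp_apply,
        h1, hV, ← List.ofFn_eq_map, ← List.ofFn_eq_map, List.prod_ofFn, Finset.prod_mul_distrib,
        prod_sqrt_kernelCoeff, prod_sqrt_kernelCoeff, ← hT.tuplePow_mul_eq m k l]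
      simp only [map_smul, smul_smul, mul_apply_eq_comp]
    have hf0 : adjoint V f = 0 := by
      rw [V.orthogonal_range] at hf
      exact hf
    have h2 := sub_prod_one_sub_mem_iSup_range (fun i => Bergman.ampl m m i (P i))
      (List.finRange n) f
    rwa [hR, comp_apply, hf0, map_zero, sub_zero] at h2

/-- An isometry that intertwines `T*` with the adjoint shifts identifies `T` with the compression
of the shifts to its range. -/
lemma exists_equiv_compression (hT : ∀ i j, Commute (T i) (T j)) {V : H →L[ℂ] Bergman m F}
    (hV : ∀ h k, Bergman.coeff (V h) k = (Real.sqrt (kernelCoeff m k) : ℂ) •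
        D (tuplePow (fun i => adjoint (T i)) k h))
    (hVV : ∀ x y, ⟪V x, V y⟫_ℂ = ⟪x, y⟫_ℂ) {S : Submodule ℂ (Bergman m F)}
    (hS : S = (LinearMap.range (V : H →ₗ[ℂ] Bergman m F))ᗮ) :
    ∃ U : H ≃ₗᵢ[ℂ] Sᗮ, ∀ i h, U (T i h) = compression Sᗮ (shift m F i) (U h) := by
  set V' : H →ₗᵢ[ℂ] Bergman m F := (V : H →ₗ[ℂ] Bergman m F).isometryOfInner hVV with hV'
  have hcl : IsClosed (LinearMap.range (V : H →ₗ[ℂ] Bergman m F) : Set (Bergman m F)) := by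
    have := V'.isometry.isClosedEmbedding.isClosed_range
    rw [LinearMap.coe_range]
    exact this
  have hr : LinearMap.range (V : H →ₗ[ℂ] Bergman m F) = Sᗮ := by
    rw [hS, Submodule.orthogonal_orthogonal_eq_closure, hcl.submodule_topologicalClosure_eq]
  set U : H ≃ₗᵢ[ℂ] Sᗮ := V'.equivRange.trans (LinearIsometryEquiv.ofEq _ _ hr) with hU
  have hUV : ∀ h, (U h : Bergman m F) = V h := fun h => rfl
  refine ⟨U, fun i h => Subtype.ext ?_⟩
  have h1 : Sᗮ.starProjection (shift m F i (V h)) = V (T i h) := by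
    refine Submodule.eq_starProjection_of_mem_orthogonal (hr ▸ ⟨_, rfl⟩) ?_
    rw [← hr, Submodule.mem_orthogonal]
    rintro _ ⟨x, rfl⟩
    simp only [coe_coe]
    rw [inner_sub_right, ← adjoint_inner_left (shift m F i), Bergman.adjoint_shift,
      backwardShift_of_coeff hT hV, hVV, hVV, adjoint_inner_left, sub_self]
  exact h1.symm

end

/-- The joint defect operator, with values in the joint defect space. -/
lemma exists_dense_defect {H : Type*} [NormedAddCommGroup H] [InnerProductSpace ℂ H]
    [CompleteSpace H] {n : ℕ} {m : Fin n → ℕ+} {T : Fin n → H →L[ℂ] H}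
    (hT : (jointInvKernel m T).IsPositive) :
    ∃ D : H →L[ℂ] defectSpace m T, DenseRange D ∧
      ∀ x y, ⟪D x, D y⟫_ℂ = ⟪jointInvKernel m T x, y⟫_ℂ := by
  have hmem : ∀ x, defectOp m T x ∈ defectSpace m T := fun x => subset_closure ⟨x, rfl⟩
  refine ⟨(defectOp m T).codRestrict _ hmem, fun y => ?_, fun x y => inner_sqrt hT x y⟩
  rw [closure_subtype, ← Set.range_comp]
  exact y.2

end BergmanModel

end

theorem mainTheorem1 {H : Type u} [NormedAddCommGroup H] [InnerProductSpace ℂ H] [CompleteSpace H]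
    {n : ℕ} (m : Fin n → ℕ+) (T : Fin n → H →L[ℂ] H)
    (hdc : IsDoublyCommuting T) (hT : IsBContractive m T) :
    ∃ (E : Fin n → Type u) (_ : ∀ k, NormedAddCommGroup (E k))
      (_ : ∀ k, InnerProductSpace ℂ (E k)) (_ : ∀ k, CompleteSpace (E k))
      (θ : ∀ k, ℂ → E k →L[ℂ] defectSpace m T),
      (∀ k, IsPartiallyIsometricMultiplier (fun _ : Fin 1 => 1) (fun _ : Fin 1 => m k)
        (inVar 0 (θ k))) ∧
      ∃ hΘ : ∀ k, IsMultiplier (hatIndex m k) m (inVar k (θ k)),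
        (∀ k, IsPartialIsometry (hΘ k).mulOp) ∧
        IsClosed (rangeSum hΘ : Set (Bergman m (defectSpace m T))) ∧
        ∃ U : H ≃ₗᵢ[ℂ] (rangeSum hΘ)ᗮ, ∀ i h,
          U (T i h) = compression (rangeSum hΘ)ᗮ (shift m (defectSpace m T) i) (U h) := by
  have hp : ∀ i, IsPure (T i) := fun i => (hT.contraction i).1
  obtain ⟨D, hDr, hD⟩ := exists_dense_defect hT.positive
  obtain ⟨V, hV, hVV⟩ := hdc.exists_dilation hp hT.positive hD
  choose W hW hWW using hdc.exists_dilation_component hp hT.positive hD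
  choose θ B hθ hker hgram using fun i => exists_beurling (m i)
    (LinearMap.range (W i : H →ₗ[ℂ] Bergman (fun _ : Fin 1 => m i) (defectSpace m T)))ᗮ
    fun f hf => shift_mem_orthogonal_range (hW i) hf
  have hol : ∀ {d : ℕ} (i : Fin d) k, DifferentiableOn ℂ (inVar i (θ k)) (polydisc d) :=
    fun i k => (hθ k).comp (differentiable_apply i).differentiableOn
      fun z hz => mem_ball_zero_iff.2 (hz i)
  have hA₁ := fun k => apply_of_adjoint_kerFun
    (A := ContinuousLinearMap.adjoint (B k)) (Θ := inVar 0 (θ k))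
    (fun z v => by rw [ContinuousLinearMap.adjoint_adjoint]; exact hker k z v)
  have hA := fun k => apply_of_adjoint_kerFun
    (A := ContinuousLinearMap.adjoint (Bergman.ampl m (hatIndex m k) k (B k))) (Θ := inVar k (θ k))
    (fun z v => by
      rw [ContinuousLinearMap.adjoint_adjoint]
      exact Bergman.ampl_kerFun (m₂ := hatIndex m k) k rfl
        (Function.update_self _ _ _) (fun j hj => (Function.update_of_ne hj _ _).symm) (hker k) z v)
  have hΘ₁ : ∀ k, IsMultiplier (fun _ : Fin 1 => 1) (fun _ : Fin 1 => m k) (inVar 0 (θ k)) :=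
    fun k => ⟨hol 0 k, fun f => ⟨_, hA₁ k f⟩⟩
  have hΘ : ∀ k, IsMultiplier (hatIndex m k) m (inVar k (θ k)) :=
    fun k => ⟨hol k k, fun f => ⟨_, hA k f⟩⟩
  have hop := fun k => (hΘ k).mulOp_eq (hA k)
  have hproj : ∀ k, IsStarProjection (LinearMap.range (W k : H →ₗ[ℂ]
      Bergman (fun _ : Fin 1 => m k) (defectSpace m T)))ᗮ.starProjection :=
    fun k => isStarProjection_starProjection
  have hS : rangeSum hΘ =
      (LinearMap.range (V : H →ₗ[ℂ] Bergman m (defectSpace m T)))ᗮ := by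
    rw [← hdc.iSup_range_ampl hDr hD hV hW hWW, rangeSum]
    refine iSup_congr fun k => ?_
    rw [hop, range_adjoint_of_gram (Bergman.isStarProjection_ampl k (hproj k))
      (Bergman.inner_ampl_ampl k (hgram k))]
  refine ⟨_, _, _, inferInstance, θ, fun k => ⟨hΘ₁ k, ?_⟩, hΘ, fun k => ?_, ?_,
    exists_equiv_compression hdc.commute hV hVV hS⟩
  · rw [(hΘ₁ k).mulOp_eq (hA₁ k)]
    exact isPartialIsometry_adjoint_of_gram (hproj k) (hgram k)
  · rw [hop]
    exact isPartialIsometry_adjoint_of_gram (Bergman.isStarProjection_ampl k (hproj k))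
      (Bergman.inner_ampl_ampl k (hgram k))
  · rw [hS]
    exact Submodule.isClosed_orthogonal _
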